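/- Let $d,m\ge 1$, let $X$ be an $\mathbb{R}^m$-valued random variable on a probability space, and let $U:\mathbb{R}^d\times\mathbb{R}^m\to\mathbb{R}$ be measurable, differentiable in its first argument, with $\mathbb{E}|U(\theta,X)|<\infty$ for every $\theta\in\mathbb{R}^d$. Suppose that $u(\theta):=\mathbb{E}[U(\theta,X)]$ is four times continuously differentiable on $\mathbb{R}^d$, and write $H(\theta)$ for its Hessian. Assume: (Lipschitzness) There exist $\varphi:\mathbb{R}^m\to[1,\infty)$ with $\mathbb{E}\big[|(1+|X|)\varphi(X)|^4\big]<\infty$ and constants $L_1,L_2>0$ such that for all $x,x'\in\mathbb{R}^m$ and $\theta,\theta'\in\mathbb{R}^d$ $$|\nabla_\theta U(\theta,x)-\nabla_\theta U(\theta',x)|\le L_1\varphi(x)|\theta-\theta'|,\qquad |\nabla_\theta U(\theta,x)-\nabla_\theta U(\theta,x')|\le L_2(\varphi(x)+\varphi(x'))(1+|\theta|)|x-x'|.$$ (Dissipativity) There exist a measurable function $A$ from $\mathbb{R}^m$ to the symmetric $d\times d$ real matrices and a measurable $\hat b:\mathbb{R}^m\to\mathbb{R}$, with $A(X)$ and $\hat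 b(X)$ integrable, such that $\langle y,A(x)y\rangle\ge 0$ and $\langle\nabla_\theta U(\theta,x),\theta\rangle\ge\langle\theta,A(x)\theta\rangle-\hat b(x)$ for all $x\in\mathbb{R}^m$ and $y,\theta\in\mathbb{R}^d$; moreover the smallest eigenvalue of $\mathbb{E}[A(X)]$ is positive and $\mathbb{E}[\hat b(X)]>0$. For $\sigma>0$ let $\epsilon\sim\mathcal{N}(0,\sigma^2I_d)$ and put $$g_\epsilon(\theta):=\mathbb{E}[u(\theta+\epsilon)],\qquad v(\theta):=u(\theta)+\tfrac{\sigma^2}{2}\operatorname{tr}H(\theta),$$ and for $\beta>0$ let $\pi_\beta^{\mathrm{fSGLD}}$ and $\pi^\star_{\beta,\sigma}$ be the probability measures on $\mathbb{R}^d$ with Lebesgue densities proportional to $\exp(-\beta g_\epsilon)$ and $\exp(-\beta v)$, respectively. Fix $\eta>0$ and let $\sigma=\sigma(\beta)=\beta^{-(1+\eta)/4}$. Then for every $\beta>0$ these objects are well defined (that is, $u(\theta+\epsilon)$ is integrable for every $\theta$, and both densities can be normalized), and $$\lim_{\beta\to\infty}\mathrm{KL}\big(\pi_\beta^{\mathrm{fSGLD}}\,\|\,\pi^\star_{\beta,\sigma}\big)=0\qquad\text{and}\qquad\lim_{\beta\to\infty}W_2\big(\pi_\beta^{\mathrm{fSGLD}},\pi^\star_{\beta,\sigma}\big)=0,$$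 where $\mathrm{KL}(\mu\|\nu)=\int\log\frac{d\mu}{d\nu}\,d\mu$ if $\mu\ll\nu$ and $\infty$ otherwise, and $W_2(\mu,\nu)=\big(\inf_\Gamma\int|x-y|^2\,d\Gamma(x,y)\big)^{1/2}$, the infimum being over all couplings $\Gamma$ of $\mu$ and $\nu$. -/

import Mathlib

open MeasureTheory ProbabilityTheory Filter Topology
open scoped ENNReal

/-- The space `ℝ^d` with the Euclidean norm. -/
abbrev RR (d : ℕ) : Type := EuclideanSpace ℝ (Fin d)

/-- The couplings of `μ` and `ν`: measures on the product with marginals `μ` and `ν`. -/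
def IsCoupling {d : ℕ} (μ ν : Measure (RR d)) (Γ : Measure (RR d × RR d)) : Prop :=
  Γ.map Prod.fst = μ ∧ Γ.map Prod.snd = ν

/-- The Wasserstein distance of order `p` on `ℝ^d`, with values in `[0, ∞]`. -/
noncomputable def wasserstein {d : ℕ} (p : ℝ) (μ ν : Measure (RR d)) : ℝ≥0∞ :=
  (⨅ (Γ : Measure (RR d × RR d)) (_ : IsCoupling μ ν Γ), ∫⁻ z, ‖z.1 - z.2‖ₑ ^ p ∂Γ) ^ (1 / p)

/-- The population objective `u(θ) = E[U(θ, X)]`. -/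
noncomputable def objective {Ω : Type*} [MeasurableSpace Ω] (P : Measure Ω) {d m : ℕ}
    (U : RR d → RR m → ℝ) (X : Ω → RR m) (θ : RR d) : ℝ :=
  ∫ ω, U θ (X ω) ∂P

/-- The Hessian matrix of `u` at `θ`, with entries `∂ᵢ ∂ⱼ u(θ)`. -/
noncomputable def hessian {d : ℕ} (u : RR d → ℝ) (θ : RR d) : Matrix (Fin d) (Fin d) ℝ :=
  Matrix.of fun i j =>
    iteratedFDeriv ℝ 2 u θ ![EuclideanSpace.single i 1, EuclideanSpace.single j 1]

/-- The Hessian-trace-regularized objective `v(θ) = u(θ) + (σ² / 2) tr H(θ)`. -/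
noncomputable def flatObjective {d : ℕ} (u : RR d → ℝ) (σ : ℝ) (θ : RR d) : ℝ :=
  u θ + σ ^ 2 / 2 * (hessian u θ).trace

/-- The law `N(0, σ² I_d)` of the perturbation `ε`. -/
noncomputable def noiseLaw (d : ℕ) (σ : ℝ) : Measure (RR d) :=
  multivariateGaussian 0 (σ ^ 2 • (1 : Matrix (Fin d) (Fin d) ℝ))

/-- The randomized-smoothing surrogate `g_ε(θ) = E[u(θ + ε)]`, where `ε ∼ N(0, σ² I_d)`. -/
noncomputable def surrogate {d : ℕ} (u : RR d → ℝ) (σ : ℝ) (θ : RR d) : ℝ :=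
  ∫ z, u (θ + z) ∂(noiseLaw d σ)

/-- The Gibbs measure with density proportional to `exp (-β f)` with respect to Lebesgue measure. -/
noncomputable def gibbs {d : ℕ} (β : ℝ) (f : RR d → ℝ) : Measure (RR d) :=
  (volume : Measure (RR d)).tilted fun θ => -β * f θ

/-- The invariant measure of fSGLD: the Gibbs measure of the surrogate objective. -/
noncomputable def piFSGLD {d : ℕ} (u : RR d → ℝ) (σ β : ℝ) : Measure (RR d) :=
  gibbs β (surrogate u σ)

/-- The target: the Gibbs measure of the Hessian-trace-regularized objective. -/
noncomputable def piStar {d : ℕ} (u : RR d → ℝ) (σ β : ℝ) : Measure (RR d) :=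
  gibbs β (flatObjective u σ)

/-- The Lipschitz assumption on the stochastic gradient `∇_θ U(θ, x)`. -/
def LipschitzAssumption {Ω : Type*} [MeasurableSpace Ω] (P : Measure Ω) {d m : ℕ}
    (U : RR d → RR m → ℝ) (X : Ω → RR m) : Prop :=
  ∃ (φ : RR m → ℝ) (L₁ L₂ : ℝ), 0 < L₁ ∧ 0 < L₂ ∧ (∀ x, 1 ≤ φ x) ∧
    Integrable (fun ω => |(1 + ‖X ω‖) * φ (X ω)| ^ 4) P ∧
    (∀ x θ θ', ‖gradient (fun t => U t x) θ - gradient (fun t => U t x) θ'‖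
      ≤ L₁ * φ x * ‖θ - θ'‖) ∧
    (∀ x x' θ, ‖gradient (fun t => U t x) θ - gradient (fun t => U t x') θ‖
      ≤ L₂ * (φ x + φ x') * (1 + ‖θ‖) * ‖x - x'‖)

/-- The dissipativity assumption on the stochastic gradient `∇_θ U(θ, x)`. -/
def DissipativityAssumption {Ω : Type*} [MeasurableSpace Ω] (P : Measure Ω) {d m : ℕ}
    (U : RR d → RR m → ℝ) (X : Ω → RR m) : Prop :=
  ∃ (A : RR m → Matrix (Fin d) (Fin d) ℝ) (b : RR m → ℝ),
    (∀ i j, Measurable fun x => A x i j) ∧ Measurable b ∧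
    (∀ x, (A x).IsSymm) ∧
    (∀ x (y : RR d), 0 ≤ inner ℝ y ((A x).toEuclideanLin y)) ∧
    (∀ x (θ : RR d), inner ℝ θ ((A x).toEuclideanLin θ) - b x
      ≤ inner ℝ (gradient (fun t => U t x) θ) θ) ∧
    (∀ i j, Integrable (fun ω => A (X ω) i j) P) ∧
    Integrable (fun ω => b (X ω)) P ∧
    (∃ a : ℝ, 0 < a ∧ IsLeast {μ : ℝ | Module.End.HasEigenvalue
      (Matrix.toLin' (Matrix.of fun i j => ∫ ω, A (X ω) i j ∂P)) μ} a) ∧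
    0 < ∫ ω, b (X ω) ∂P

/-!
The proof reduces everything to two inequalities for the objective `u`: a quadratic bound
`|u(θ + z) + u(θ - z) - 2 u(θ)| ≤ L |z|²` on second differences
(`exists_objective_second_difference_le`) and quadratic growth `u(θ) ≥ c |θ|² - C`
(`exists_objective_dissipative`, `exists_quadratic_lower_bound`). Both come from integrating the
first-order expansion of `U(·, x)` against the law of `X`, so that no differentiation under the
expectation is needed.

Since the noise is symmetric with covariance `σ² I`, the difference `v - g_ε` is half the
expectation of `D²u(θ)[ε, ε] - (u(θ + ε) + u(θ - ε) - 2 u(θ))`. Taylor's formula makes this `O(σ⁴)`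
uniformly on balls (`exists_abs_flatObjective_sub_surrogate_le`). The fourth derivative of `u` is
not globally bounded, and on the whole space only the bound `O(σ²)` is available.

The surrogate Gibbs measure is the tilting of the target by `exp F` with `F = β (v - g_ε)`
(`piFSGLD_eq_tilted`). On a fixed ball `|F| = O(β σ⁴) = O(β^(-η))`, and everywhere `|F| = O(β)`.
By quadratic growth both measures give the complement of a large ball mass and second moment
`O(exp (-β))` (`exists_gibbs_tail_le`), which beats the growth of `F` there.

For the divergence, Jensen's inequality gives
`KL ≤ ∫ F dπ^fSGLD - ∫ F dπ^⋆` (`klDiv_tilted_le`), and both integrals tend to `0`. For `W₂`, a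
multiple of `π^⋆` restricted to the ball, of mass tending to `1`, lies below both measures
(`smul_restrict_le_tilted`). Keeping this part on the diagonal and coupling the remainders
independently costs at most twice the second moments of the remainders
(`wasserstein_two_le_of_common_part`), which tend to `0`.
-/

/-! ### Wasserstein distance of measures with a common part -/

lemma enorm_sub_sq_le {d : ℕ} (x y : RR d) :
    ‖x - y‖ₑ ^ (2 : ℝ) ≤ 2 * ‖x‖ₑ ^ (2 : ℝ) + 2 * ‖y‖ₑ ^ (2 : ℝ) := by
  calc ‖x - y‖ₑ ^ (2 : ℝ) ≤ (‖x‖ₑ + ‖y‖ₑ) ^ (2 : ℝ) := by gcongr; exact enorm_sub_le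
    _ ≤ 2 ^ ((2 : ℝ) - 1) * (‖x‖ₑ ^ (2 : ℝ) + ‖y‖ₑ ^ (2 : ℝ)) :=
        ENNReal.rpow_add_le_mul_rpow_add_rpow _ _ (by norm_num)
    _ = _ := by norm_num [mul_add]

/-- If `μ` and `ν` share the part `κ`, the coupling that keeps `κ` on the diagonal and couples the
remainders `ρ₁`, `ρ₂` independently costs at most twice the second moments of the remainders. -/
lemma wasserstein_two_add_le {d : ℕ} (κ ρ₁ ρ₂ : Measure (RR d)) [IsFiniteMeasure κ]
    [IsFiniteMeasure ρ₁] [IsFiniteMeasure ρ₂] (h : ρ₁ Set.univ = ρ₂ Set.univ) :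
    wasserstein 2 (κ + ρ₁) (κ + ρ₂) ≤
      (2 * ∫⁻ x, ‖x‖ₑ ^ (2 : ℝ) ∂ρ₁ + 2 * ∫⁻ x, ‖x‖ₑ ^ (2 : ℝ) ∂ρ₂) ^ ((1 : ℝ) / 2) := by
  unfold wasserstein
  gcongr
  set m : ℝ≥0∞ := ρ₁ Set.univ with hm
  have hmtop : m ≠ ∞ := measure_ne_top _ _
  -- For `m = 0` the scalar `m⁻¹ = ∞` is harmless, since both remainders vanish.
  have hcancel : ∀ ρ : Measure (RR d), ρ Set.univ = m → (m⁻¹ * m) • ρ = ρ := by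
    intro ρ hρ
    rcases eq_or_ne m 0 with h0 | h0
    · have : ρ = 0 := by rw [← Measure.measure_univ_eq_zero, hρ, h0]
      simp [this]
    · rw [ENNReal.inv_mul_cancel h0 hmtop, one_smul]
  have hdiag : Measurable fun x : RR d => (x, x) := by fun_prop
  have hcoupling : IsCoupling (κ + ρ₁) (κ + ρ₂)
      (κ.map (fun x => (x, x)) + m⁻¹ • ρ₁.prod ρ₂) := by
    refine ⟨?_, ?_⟩
    · rw [Measure.map_add _ _ measurable_fst, Measure.map_map measurable_fst hdiag,
        Measure.map_smul, Measure.map_fst_prod, smul_smul, ← h, hcancel ρ₁ rfl]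
      congr 1
      exact Measure.map_id
    · rw [Measure.map_add _ _ measurable_snd, Measure.map_map measurable_snd hdiag,
        Measure.map_smul, Measure.map_snd_prod, smul_smul, hcancel ρ₂ h.symm]
      congr 1
      exact Measure.map_id
  refine (iInf₂_le _ hcoupling).trans ?_
  have hmeas : Measurable fun x : RR d => ‖x‖ₑ ^ (2 : ℝ) := by fun_prop
  rw [lintegral_add_measure, lintegral_map (by fun_prop) hdiag, lintegral_smul_measure]
  have h1 : ∫⁻ z, ‖z.1 - z.2‖ₑ ^ (2 : ℝ) ∂(ρ₁.prod ρ₂) ≤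
      m * (2 * ∫⁻ x, ‖x‖ₑ ^ (2 : ℝ) ∂ρ₁ + 2 * ∫⁻ x, ‖x‖ₑ ^ (2 : ℝ) ∂ρ₂) := by
    calc ∫⁻ z, ‖z.1 - z.2‖ₑ ^ (2 : ℝ) ∂(ρ₁.prod ρ₂)
        ≤ ∫⁻ z, (2 * ‖z.1‖ₑ ^ (2 : ℝ) + 2 * ‖z.2‖ₑ ^ (2 : ℝ)) ∂(ρ₁.prod ρ₂) :=
          lintegral_mono fun z => enorm_sub_sq_le z.1 z.2
      _ = ∫⁻ x, (2 * ‖x‖ₑ ^ (2 : ℝ) * m + 2 * ∫⁻ y, ‖y‖ₑ ^ (2 : ℝ) ∂ρ₂) ∂ρ₁ := by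
          rw [lintegral_prod _ (by fun_prop)]
          refine lintegral_congr fun x => ?_
          rw [lintegral_add_left (by fun_prop), lintegral_const_mul _ hmeas]
          simp only [lintegral_const, ← h]
      _ = _ := by
          rw [lintegral_add_left (by fun_prop), lintegral_const, lintegral_mul_const _ (by fun_prop),
            lintegral_const_mul _ hmeas, ← hm]
          ring
  simp only [sub_self, enorm_zero, smul_eq_mul]
  rw [ENNReal.zero_rpow_of_pos (by norm_num), lintegral_zero, zero_add]
  calc _ ≤ m⁻¹ * (m * _) := by gcongr
    _ ≤ _ := by
      rw [← mul_assoc]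
      exact mul_le_of_le_one_left' (ENNReal.inv_mul_le_one m)

/-- A part `κ` common to two probability measures whose mass is close to `1` makes them close in
`W₂`, up to their second moments outside the ball of radius `R`. -/
lemma wasserstein_two_le_of_common_part {d : ℕ} (μ ν κ : Measure (RR d)) [IsProbabilityMeasure μ]
    [IsProbabilityMeasure ν] (hμ : κ ≤ μ) (hν : κ ≤ ν) (R : ℝ) :
    wasserstein 2 μ ν ≤
      (4 * (ENNReal.ofReal R ^ (2 : ℝ) * (1 - κ Set.univ)) +
        2 * ∫⁻ x in (Metric.closedBall 0 R)ᶜ, ‖x‖ₑ ^ (2 : ℝ) ∂μ +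
        2 * ∫⁻ x in (Metric.closedBall 0 R)ᶜ, ‖x‖ₑ ^ (2 : ℝ) ∂ν) ^ ((1 : ℝ) / 2) := by
  have : IsFiniteMeasure κ := isFiniteMeasure_of_le μ hμ
  have hmass : ∀ τ : Measure (RR d), IsProbabilityMeasure τ → κ ≤ τ →
      (τ - κ) Set.univ = 1 - κ Set.univ := by
    intro τ hτ hle
    rw [Measure.sub_apply MeasurableSet.univ hle, measure_univ]
  have hmom : ∀ τ : Measure (RR d), IsProbabilityMeasure τ → κ ≤ τ →
      ∫⁻ x, ‖x‖ₑ ^ (2 : ℝ) ∂(τ - κ) ≤ ENNReal.ofReal R ^ (2 : ℝ) * (1 - κ Set.univ) +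
        ∫⁻ x in (Metric.closedBall 0 R)ᶜ, ‖x‖ₑ ^ (2 : ℝ) ∂τ := by
    intro τ hτ hle
    rw [← lintegral_add_compl _ (Metric.isClosed_closedBall (x := (0 : RR d))
      (ε := R)).measurableSet]
    gcongr
    · calc _ ≤ ∫⁻ x in Metric.closedBall 0 R, ENNReal.ofReal R ^ (2 : ℝ) ∂(τ - κ) := by
            refine setLIntegral_mono' Metric.isClosed_closedBall.measurableSet fun x hx => ?_
            gcongr
            rw [← ofReal_norm]
            exact ENNReal.ofReal_le_ofReal (by simpa using hx)
        _ ≤ _ := by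
            rw [setLIntegral_const, ← hmass τ hτ hle]
            gcongr
            exact Set.subset_univ _
    · exact Measure.sub_le
  have h := wasserstein_two_add_le κ (μ - κ) (ν - κ)
    (by rw [hmass μ inferInstance hμ, hmass ν inferInstance hν])
  rw [add_comm κ, add_comm κ, Measure.sub_add_cancel_of_le hμ,
    Measure.sub_add_cancel_of_le hν] at h
  refine h.trans (ENNReal.rpow_le_rpow ?_ (by norm_num))
  refine (add_le_add (mul_le_mul_right (hmom μ inferInstance hμ) 2)
    (mul_le_mul_right (hmom ν inferInstance hν) 2)).trans (le_of_eq ?_)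
  ring

/-! ### Comparison of a probability measure with an exponential tilting of it -/

section Tilted

variable {α : Type*} [MeasurableSpace α] {ν : Measure α} [IsProbabilityMeasure ν] {F : α → ℝ}
  {s : Set α} {δ D : ℝ}

lemma abs_integral_le_of_bound_on (hs : MeasurableSet s) (hF : Measurable F)
    (hδ0 : 0 ≤ δ) (hD : ∀ x, |F x| ≤ D) (hδ : ∀ x ∈ s, |F x| ≤ δ) :
    |∫ x, F x ∂ν| ≤ δ + D * ν.real sᶜ := by
  have hint : Integrable F ν :=
    Integrable.of_bound hF.aestronglyMeasurable D (ae_of_all _ hD)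
  rw [← integral_add_compl hs hint]
  simp only [← Real.norm_eq_abs] at hD hδ ⊢
  refine (norm_add_le _ _).trans (add_le_add ?_ ?_)
  · refine (norm_setIntegral_le_of_norm_le_const (measure_lt_top _ _) hδ).trans ?_
    exact mul_le_of_le_one_right hδ0 measureReal_le_one
  · exact norm_setIntegral_le_of_norm_le_const (measure_lt_top _ _) fun x _ => hD x

lemma integrable_exp_of_bound (hF : Measurable F) (hD : ∀ x, |F x| ≤ D) :
    Integrable (fun x => Real.exp (F x)) ν := by
  refine Integrable.of_bound (by fun_prop) (Real.exp D) (ae_of_all _ fun x => ?_)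
  rw [Real.norm_eq_abs, Real.abs_exp]
  exact Real.exp_le_exp.2 ((le_abs_self _).trans (hD x))

/-- The log-density of the tilting is `F - log ∫ exp F dν`, and `log ∫ exp F dν ≥ ∫ F dν` by
Jensen's inequality. -/
lemma klDiv_tilted_le (hs : MeasurableSet s) (hF : Measurable F)
    (hδ0 : 0 ≤ δ) (hD : ∀ x, |F x| ≤ D) (hδ : ∀ x ∈ s, |F x| ≤ δ) :
    InformationTheory.klDiv (ν.tilted F) ν ≤
      ENNReal.ofReal (2 * δ + D * ((ν.tilted F).real sᶜ + ν.real sᶜ)) := by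
  have hexp : Integrable (fun x => Real.exp (F x)) ν := integrable_exp_of_bound hF hD
  have hprob : IsProbabilityMeasure (ν.tilted F) := isProbabilityMeasure_tilted hexp
  have hFint : ∀ τ : Measure α, IsProbabilityMeasure τ → Integrable F τ := fun τ _ =>
    Integrable.of_bound hF.aestronglyMeasurable D (ae_of_all _ hD)
  have hac : ν.tilted F ≪ ν := tilted_absolutelyContinuous ν F
  have hllr : llr (ν.tilted F) ν =ᵐ[ν.tilted F] fun x => F x - Real.log (∫ y, Real.exp (F y) ∂ν) :=
    hac.ae_le (log_rnDeriv_tilted_left_self hexp)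
  have hint : Integrable (llr (ν.tilted F) ν) (ν.tilted F) :=
    (integrable_congr hllr).2 ((hFint _ hprob).sub (integrable_const _))
  rw [InformationTheory.klDiv_of_ac_of_integrable hac hint]
  apply ENNReal.ofReal_le_ofReal
  rw [integral_congr_ae hllr, integral_sub (hFint _ hprob) (integrable_const _)]
  simp only [integral_const, probReal_univ, smul_eq_mul, one_mul]
  have h1 := abs_integral_le_of_bound_on (ν := ν.tilted F) hs hF hδ0 hD hδ
  have h2 := abs_integral_le_of_bound_on (ν := ν) hs hF hδ0 hD hδ
  have hJ : ∫ x, F x ∂ν ≤ Real.log (∫ y, Real.exp (F y) ∂ν) := by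
    rw [Real.le_log_iff_exp_le (integral_exp_pos hexp)]
    exact convexOn_exp.map_integral_le Real.continuous_exp.continuousOn isClosed_univ
      (ae_of_all _ fun _ => Set.mem_univ _) (hFint ν inferInstance) hexp
  have h1' := (le_abs_self _).trans h1
  have h2' := (neg_abs_le (∫ x, F x ∂ν))
  linarith

/-- Where `|F| ≤ δ`, the density of the tilting is at least `exp (-2 δ)` times the mass of that
set, so this multiple of `ν` restricted to the set lies below the tilting. -/
lemma smul_restrict_le_tilted (hs : MeasurableSet s) (hF : Measurable F)
    (hD : ∀ x, |F x| ≤ D) (hδ : ∀ x ∈ s, |F x| ≤ δ) :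
    ENNReal.ofReal (Real.exp (-(2 * δ)) * (ν.tilted F).real s) • ν.restrict s ≤ ν.tilted F := by
  have hexp : Integrable (fun x => Real.exp (F x)) ν := integrable_exp_of_bound hF hD
  have hprob : IsProbabilityMeasure (ν.tilted F) := isProbabilityMeasure_tilted hexp
  set Z := ∫ y, Real.exp (F y) ∂ν with hZ
  have hZpos : 0 < Z := integral_exp_pos hexp
  -- The normalizing constant is controlled by the mass of `s` under the tilting.
  have hZle : Z * (ν.tilted F).real s ≤ Real.exp δ := by
    have : (ν.tilted F).real s = ∫ x in s, Real.exp (F x) / Z ∂ν := by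
      rw [measureReal_def, tilted_apply_eq_ofReal_integral, ENNReal.toReal_ofReal]
      exact integral_nonneg fun x => by positivity
    rw [this, integral_div, mul_div_cancel₀ _ hZpos.ne']
    refine (Real.le_norm_self _).trans ((norm_setIntegral_le_of_norm_le_const (measure_lt_top _ _)
      (C := Real.exp δ) fun x hx => ?_).trans
      (mul_le_of_le_one_right (Real.exp_pos _).le measureReal_le_one))
    rw [Real.norm_eq_abs, Real.abs_exp]
    exact Real.exp_le_exp.2 ((le_abs_self _).trans (hδ x hx))
  rw [Measure.le_iff]
  intro t ht
  rw [Measure.smul_apply, Measure.restrict_apply ht, smul_eq_mul]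
  calc _ = ∫⁻ x in t ∩ s, ENNReal.ofReal (Real.exp (-(2 * δ)) * (ν.tilted F).real s) ∂ν := by
        rw [setLIntegral_const]
    _ ≤ ∫⁻ x in t ∩ s, ENNReal.ofReal (Real.exp (F x) / Z) ∂ν := by
        refine setLIntegral_mono' (ht.inter hs) fun x hx => ENNReal.ofReal_le_ofReal ?_
        rw [le_div_iff₀ hZpos, mul_assoc, mul_comm _ Z]
        calc _ ≤ Real.exp (-(2 * δ)) * Real.exp δ := by gcongr
          _ = Real.exp (-δ) := by rw [← Real.exp_add]; congr 1; ring
          _ ≤ _ := Real.exp_le_exp.2 (neg_le_of_abs_le (hδ x hx.2))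
    _ = ν.tilted F (t ∩ s) := by rw [tilted_apply]
    _ ≤ _ := measure_mono Set.inter_subset_left

end Tilted

lemma wasserstein_two_tilted_le {d : ℕ} {ν : Measure (RR d)} [IsProbabilityMeasure ν]
    {F : RR d → ℝ} {δ D : ℝ} {R : ℝ} (hF : Measurable F)
    (hδ0 : 0 ≤ δ) (hD : ∀ x, |F x| ≤ D) (hδ : ∀ x ∈ Metric.closedBall 0 R, |F x| ≤ δ) :
    wasserstein 2 (ν.tilted F) ν ≤
      (4 * (ENNReal.ofReal R ^ (2 : ℝ) *
          ENNReal.ofReal (1 - Real.exp (-(2 * δ)) * (ν.tilted F).real (Metric.closedBall 0 R) *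
            ν.real (Metric.closedBall 0 R))) +
        2 * ∫⁻ x in (Metric.closedBall 0 R)ᶜ, ‖x‖ₑ ^ (2 : ℝ) ∂(ν.tilted F) +
        2 * ∫⁻ x in (Metric.closedBall 0 R)ᶜ, ‖x‖ₑ ^ (2 : ℝ) ∂ν) ^ ((1 : ℝ) / 2) := by
  have hs : MeasurableSet (Metric.closedBall (0 : RR d) R) :=
    Metric.isClosed_closedBall.measurableSet
  have hprob : IsProbabilityMeasure (ν.tilted F) :=
    isProbabilityMeasure_tilted (integrable_exp_of_bound hF hD)
  have hc : ENNReal.ofReal (Real.exp (-(2 * δ)) *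
      (ν.tilted F).real (Metric.closedBall 0 R)) ≤ 1 := by
    rw [ENNReal.ofReal_le_one]
    refine mul_le_one₀ (Real.exp_le_one_iff.2 (by linarith)) measureReal_nonneg measureReal_le_one
  have h := wasserstein_two_le_of_common_part (ν.tilted F) ν _
    (smul_restrict_le_tilted hs hF hD hδ)
    (by
      refine le_trans ?_
        (Measure.restrict_le_self (s := Metric.closedBall (0 : RR d) R))
      calc _ ≤ (1 : ℝ≥0∞) • ν.restrict (Metric.closedBall 0 R) := by gcongr
        _ = _ := one_smul _ _) R
  convert h using 6
  rw [Measure.smul_apply, Measure.restrict_apply_univ, smul_eq_mul, ENNReal.ofReal_sub _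
    (by positivity), ENNReal.ofReal_one, ENNReal.ofReal_mul (p := _ * _) (by positivity),
    ofReal_measureReal]

/-! ### Moments of the noise -/

lemma noiseLaw_eq_map_stdGaussian (d : ℕ) (σ : ℝ) :
    noiseLaw d σ = (stdGaussian (RR d)).map (fun z => σ • z) := by
  have hS : (σ ^ 2 • (1 : Matrix (Fin d) (Fin d) ℝ)).PosSemidef :=
    Matrix.PosSemidef.one.smul (sq_nonneg σ)
  have : IsProbabilityMeasure ((stdGaussian (RR d)).map (fun z => σ • z)) :=
    Measure.isProbabilityMeasure_map (by fun_prop)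
  unfold noiseLaw
  apply Measure.ext_of_charFun
  ext t
  rw [charFun_multivariateGaussian hS, charFun_map_smul, charFun_stdGaussian, norm_smul]
  have h : t.ofLp ⬝ᵥ (σ ^ 2 • (1 : Matrix (Fin d) (Fin d) ℝ)).mulVec t.ofLp = (‖σ‖ * ‖t‖) ^ 2 := by
    rw [mul_pow, EuclideanSpace.real_norm_sq_eq, Matrix.smul_mulVec, Matrix.one_mulVec,
      dotProduct_smul]
    simp [dotProduct, pow_two]
  rw [h]
  congr 1
  simp
  ring

instance isProbabilityMeasure_noiseLaw (d : ℕ) (σ : ℝ) : IsProbabilityMeasure (noiseLaw d σ) := by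
  unfold noiseLaw; infer_instance

lemma map_neg_noiseLaw (d : ℕ) (σ : ℝ) : (noiseLaw d σ).map (fun z => -z) = noiseLaw d σ := by
  have h := stdGaussian_map (LinearIsometryEquiv.neg ℝ (E := RR d))
  rw [noiseLaw_eq_map_stdGaussian, Measure.map_map (by fun_prop) (by fun_prop)]
  conv_rhs => rw [← h, Measure.map_map (by fun_prop) (by fun_prop)]
  congr 1
  ext1 z
  simp

lemma integrable_norm_pow_noiseLaw (d : ℕ) (σ : ℝ) (k : ℕ) :
    Integrable (fun z => ‖z‖ ^ k) (noiseLaw d σ) := by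
  unfold noiseLaw
  exact (IsGaussian.memLp_id _ k (by simp)).integrable_norm_pow'

lemma integral_norm_pow_noiseLaw (d : ℕ) (σ : ℝ) (k : ℕ) :
    ∫ z, ‖z‖ ^ k ∂(noiseLaw d σ) = |σ| ^ k * ∫ z, ‖z‖ ^ k ∂(stdGaussian (RR d)) := by
  rw [noiseLaw_eq_map_stdGaussian, integral_map (by fun_prop) (by fun_prop), ← integral_const_mul]
  simp [norm_smul, mul_pow]

lemma integrable_coord_mul_noiseLaw (d : ℕ) (σ : ℝ) (i j : Fin d) :
    Integrable (fun z => z i * z j) (noiseLaw d σ) := by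
  refine (integrable_norm_pow_noiseLaw d σ 2).mono' (by fun_prop) (ae_of_all _ fun z => ?_)
  rw [norm_mul, pow_two]
  gcongr <;> exact PiLp.norm_apply_le z _

lemma integral_coord_mul_noiseLaw (d : ℕ) (σ : ℝ) (i j : Fin d) :
    ∫ z, z i * z j ∂(noiseLaw d σ) = if i = j then σ ^ 2 else 0 := by
  have hS : (σ ^ 2 • (1 : Matrix (Fin d) (Fin d) ℝ)).PosSemidef :=
    Matrix.PosSemidef.one.smul (sq_nonneg σ)
  have hmem : ∀ i : Fin d, MemLp (fun z : RR d => z i) 2 (noiseLaw d σ) := fun i => by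
    rw [memLp_two_iff_integrable_sq (by fun_prop)]
    simpa [pow_two] using integrable_coord_mul_noiseLaw d σ i i
  have hmean : ∀ i : Fin d, ∫ z : RR d, z i ∂(noiseLaw d σ) = 0 := fun i => by
    have h : ∫ z : RR d, z i ∂(noiseLaw d σ) = ∫ z : RR d, (-z) i ∂(noiseLaw d σ) := by
      conv_lhs => rw [← map_neg_noiseLaw]
      rw [integral_map (by fun_prop) (by fun_prop)]
    simp only [PiLp.neg_apply, integral_neg] at h
    linarith
  have h : cov[fun z : RR d => z i, fun z => z j; noiseLaw d σ] =
      (σ ^ 2 • (1 : Matrix (Fin d) (Fin d) ℝ)) i j :=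
    covariance_eval_multivariateGaussian hS i j
  rw [covariance_eq_sub (hmem i) (hmem j), hmean i, zero_mul, sub_zero] at h
  simpa [Matrix.one_apply] using h

/-! ### Second differences and their fourth-order Taylor expansion -/

section Taylor

variable {E : Type*} [NormedAddCommGroup E] [NormedSpace ℝ E] {u : E → ℝ}

lemma iteratedDeriv_line {n : ℕ} (hu : ContDiff ℝ n u) (θ z : E) {k : ℕ} (hk : k ≤ n) (t : ℝ) :
    iteratedDeriv k (fun s : ℝ => u (θ + s • z)) t =
      iteratedFDeriv ℝ k u (θ + t • z) fun _ => z := by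
  have h1 : (fun s : ℝ => u (θ + s • z)) =
      (fun y => u (θ + y)) ∘ (ContinuousLinearMap.toSpanSingleton ℝ z) := by
    ext s; simp
  have h2 : ContDiff ℝ n fun y => u (θ + y) := by fun_prop
  rw [iteratedDeriv_eq_iteratedFDeriv, h1,
    ContinuousLinearMap.iteratedFDeriv_comp_right _ h2 t (by exact_mod_cast hk)]
  simp [iteratedFDeriv_comp_add_left]

/-- The odd-order terms of the Taylor expansions in the directions `z` and `-z` cancel, so that the
remainder is of fourth order. -/
lemma abs_second_difference_sub_le (hu : ContDiff ℝ 4 u) (θ z : E) {M : ℝ}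
    (hM : ∀ y ∈ Metric.closedBall θ ‖z‖, ‖iteratedFDeriv ℝ 4 u y‖ ≤ M) :
    |u (θ + z) + u (θ - z) - 2 * u θ - iteratedFDeriv ℝ 2 u θ (fun _ => z)| ≤ M * ‖z‖ ^ 4 := by
  have taylor : ∀ w : E, ‖w‖ = ‖z‖ →
      |u (θ + w) - (u θ + iteratedFDeriv ℝ 1 u θ (fun _ => w) +
        iteratedFDeriv ℝ 2 u θ (fun _ => w) / 2 +
        iteratedFDeriv ℝ 3 u θ (fun _ => w) / 6)| ≤ M * ‖z‖ ^ 4 / 6 := by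
    intro w hw
    have hline : ContDiff ℝ 4 fun s : ℝ => u (θ + s • w) := by fun_prop
    have hder : ∀ k ≤ 4, ∀ t ∈ Set.Icc (0 : ℝ) 1,
        iteratedDerivWithin k (fun s : ℝ => u (θ + s • w)) (Set.Icc 0 1) t =
          iteratedFDeriv ℝ k u (θ + t • w) fun _ => w := by
      intro k hk t ht
      rw [iteratedDerivWithin_eq_iteratedDeriv (uniqueDiffOn_Icc zero_lt_one)
        ((hline.of_le (by exact_mod_cast hk)).contDiffAt) ht]
      exact iteratedDeriv_line (n := 4) hu θ w hk t
    have h := taylor_mean_remainder_bound (f := fun s : ℝ => u (θ + s • w)) (a := 0) (b := 1)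
      (C := M * ‖z‖ ^ 4) (x := 1) (n := 3) zero_le_one (by exact_mod_cast hline.contDiffOn)
      (by simp) (fun t ht => by
        rw [hder 4 le_rfl t ht]
        refine (ContinuousMultilinearMap.le_opNorm _ _).trans ?_
        simp only [Finset.prod_const, Finset.card_univ, Fintype.card_fin, hw]
        gcongr
        apply hM
        simp only [Metric.mem_closedBall, dist_self_add_left, norm_smul, Real.norm_eq_abs,
          abs_of_nonneg ht.1, hw]
        exact mul_le_of_le_one_left (norm_nonneg _) ht.2)
    simp only [taylor_within_apply, Finset.sum_range_succ, Finset.sum_range_zero,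
      hder 0 (by norm_num) 0 (by simp), hder 1 (by norm_num) 0 (by simp),
      hder 2 (by norm_num) 0 (by simp), hder 3 (by norm_num) 0 (by simp)] at h
    norm_num [Nat.factorial] at h
    convert h using 2
    rw [iteratedFDeriv_one_apply]
    ring
  have h1 := taylor z rfl
  have h2 := taylor (-z) (norm_neg z)
  have hodd : ∀ k : ℕ, iteratedFDeriv ℝ k u θ (fun _ => -z) =
      (-1) ^ k * iteratedFDeriv ℝ k u θ (fun _ => z) := by
    intro k
    have := (iteratedFDeriv ℝ k u θ).map_smul_univ (fun _ => (-1 : ℝ)) (fun _ => z)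
    simpa using this
  rw [hodd 1, hodd 2, hodd 3, ← sub_eq_add_neg] at h2
  rw [abs_le] at h1 h2 ⊢
  have hM0 : 0 ≤ M * ‖z‖ ^ 4 := by linarith
  constructor <;> linarith

/-- A bound on second differences passes to the Hessian. -/
lemma abs_hessian_apply_le (hu : ContDiff ℝ 4 u) {L : ℝ}
    (hL : ∀ θ z, |u (θ + z) + u (θ - z) - 2 * u θ| ≤ L * ‖z‖ ^ 2) [ProperSpace E] (θ z : E) :
    |iteratedFDeriv ℝ 2 u θ (fun _ => z)| ≤ L * ‖z‖ ^ 2 := by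
  obtain ⟨M, hM⟩ := (isCompact_closedBall θ ‖z‖).exists_bound_of_continuousOn
    (hu.continuous_iteratedFDeriv (m := 4) le_rfl).norm.continuousOn
  have hbound : ∀ t ∈ Set.Ioc (0 : ℝ) 1, |iteratedFDeriv ℝ 2 u θ (fun _ => z)| ≤
      L * ‖z‖ ^ 2 + t ^ 2 * (M * ‖z‖ ^ 4) := by
    intro t ht
    have hnorm : ‖t • z‖ = t * ‖z‖ := by rw [norm_smul, Real.norm_eq_abs, abs_of_pos ht.1]
    have h1 := abs_second_difference_sub_le hu θ (t • z) (M := M) fun y hy => by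
      simpa using hM y (Metric.closedBall_subset_closedBall
        (by rw [hnorm]; exact mul_le_of_le_one_left (norm_nonneg _) ht.2) hy)
    have h2 := hL θ (t • z)
    have h3 : iteratedFDeriv ℝ 2 u θ (fun _ => t • z) =
        t ^ 2 * iteratedFDeriv ℝ 2 u θ (fun _ => z) := by
      have := (iteratedFDeriv ℝ 2 u θ).map_smul_univ (fun _ => t) (fun _ => z)
      simpa using this
    have h4 : |t ^ 2 * iteratedFDeriv ℝ 2 u θ (fun _ => z)| ≤
        t ^ 2 * (L * ‖z‖ ^ 2 + t ^ 2 * (M * ‖z‖ ^ 4)) := by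
      rw [h3, hnorm] at h1
      rw [hnorm] at h2
      rw [abs_le] at h1 h2 ⊢
      constructor <;> linarith
    rw [abs_mul, abs_of_pos (pow_pos ht.1 2)] at h4
    exact le_of_mul_le_mul_left h4 (pow_pos ht.1 2)
  have hlim : Tendsto (fun t : ℝ => L * ‖z‖ ^ 2 + t ^ 2 * (M * ‖z‖ ^ 4)) (𝓝[>] 0)
      (𝓝 (L * ‖z‖ ^ 2)) := by
    refine tendsto_nhdsWithin_of_tendsto_nhds ?_
    have : ContinuousAt (fun t : ℝ => L * ‖z‖ ^ 2 + t ^ 2 * (M * ‖z‖ ^ 4)) 0 := by fun_prop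
    simpa [ContinuousAt] using this
  refine ge_of_tendsto hlim ?_
  filter_upwards [Ioc_mem_nhdsGT (zero_lt_one' ℝ)] with t ht using hbound t ht

/-- The fourth derivative is bounded only locally; for displacements larger than `1` the quadratic
bounds on second difference and Hessian are dominated by the fourth power. -/
lemma exists_second_difference_sub_le (hu : ContDiff ℝ 4 u) [ProperSpace E] {L : ℝ}
    (hL : ∀ θ z, |u (θ + z) + u (θ - z) - 2 * u θ| ≤ L * ‖z‖ ^ 2) (hL0 : 0 ≤ L) (R : ℝ) :
    ∃ C, 0 ≤ C ∧ ∀ θ ∈ Metric.closedBall (0 : E) R, ∀ z,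
      |u (θ + z) + u (θ - z) - 2 * u θ - iteratedFDeriv ℝ 2 u θ (fun _ => z)| ≤ C * ‖z‖ ^ 4 := by
  obtain ⟨M, hM⟩ := (isCompact_closedBall (0 : E) (R + 1)).exists_bound_of_continuousOn
    (hu.continuous_iteratedFDeriv (m := 4) le_rfl).norm.continuousOn
  refine ⟨max M 0 + 2 * L, by positivity, fun θ hθ z => ?_⟩
  rcases le_total ‖z‖ 1 with hz | hz
  · refine (abs_second_difference_sub_le hu θ z (M := M) fun y hy => ?_).trans ?_
    · simpa using hM y (Metric.closedBall_subset_closedBall' (by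
        rw [Metric.mem_closedBall] at hθ; linarith) hy)
    · gcongr
      linarith [le_max_left M 0]
  · have h1 := hL θ z
    have h2 := abs_hessian_apply_le hu hL θ z
    have h3 : ‖z‖ ^ 2 ≤ ‖z‖ ^ 4 := pow_le_pow_right₀ hz (by norm_num)
    calc _ ≤ L * ‖z‖ ^ 2 + L * ‖z‖ ^ 2 := (abs_sub _ _).trans (add_le_add h1 h2)
      _ ≤ L * ‖z‖ ^ 4 + L * ‖z‖ ^ 4 := by gcongr
      _ ≤ _ := by
        rw [← add_mul, ← two_mul]
        gcongr
        exact le_add_of_nonneg_left (le_max_right M 0)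

end Taylor

/-! ### The surrogate and the regularized objective -/

section Surrogate

variable {d : ℕ} {u : RR d → ℝ} {L c C σ : ℝ}

lemma integrable_comp_add_noiseLaw (hu : Continuous u)
    (hL : ∀ θ z, |u (θ + z) + u (θ - z) - 2 * u θ| ≤ L * ‖z‖ ^ 2) (hC : ∀ θ, -C ≤ u θ)
    (σ : ℝ) (θ : RR d) : Integrable (fun z => u (θ + z)) (noiseLaw d σ) := by
  refine (((integrable_norm_pow_noiseLaw d σ 2).const_mul L).add
    (integrable_const (|C| + 2 * |u θ|))).mono' (by fun_prop) (ae_of_all _ fun z => ?_)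
  have h1 := (abs_le.1 (hL θ z)).2
  have h2 := hC (θ - z)
  have h3 := hC (θ + z)
  have h4 := (abs_nonneg _).trans (hL θ z)
  have h5 := le_abs_self C
  have h6 := le_abs_self (u θ)
  have h7 := abs_nonneg (u θ)
  simp only [Pi.add_apply]
  rw [Real.norm_eq_abs, abs_le]
  constructor <;> linarith

/-- Averaging over `z` and `-z`, which is possible by the symmetry of the noise. -/
lemma surrogate_sub_eq (hint : ∀ θ, Integrable (fun z => u (θ + z)) (noiseLaw d σ)) (θ : RR d) :
    surrogate u σ θ - u θ =
      (∫ z, (u (θ + z) + u (θ - z) - 2 * u θ) ∂(noiseLaw d σ)) / 2 := by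
  have hmp : MeasurePreserving (fun z : RR d => -z) (noiseLaw d σ) (noiseLaw d σ) :=
    ⟨by fun_prop, map_neg_noiseLaw d σ⟩
  have hemb : MeasurableEmbedding (fun z : RR d => -z) :=
    (Homeomorph.neg (RR d)).measurableEmbedding
  have hint' : Integrable (fun z => u (θ - z)) (noiseLaw d σ) := by
    simpa [Function.comp_def, ← sub_eq_add_neg] using (hmp.integrable_comp_emb hemb).2 (hint θ)
  have hneg : ∫ z, u (θ - z) ∂(noiseLaw d σ) = surrogate u σ θ := by
    simpa [surrogate, ← sub_eq_add_neg] using hmp.integral_comp hemb fun z => u (θ + z)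
  have hsplit : ∫ z, (u (θ + z) + u (θ - z) - 2 * u θ) ∂(noiseLaw d σ) =
      ∫ z, u (θ + z) ∂(noiseLaw d σ) + ∫ z, u (θ - z) ∂(noiseLaw d σ) - ∫ _, 2 * u θ
        ∂(noiseLaw d σ) := by
    rw [← integral_add (hint θ) hint']
    exact integral_sub ((hint θ).add hint') (integrable_const _)
  rw [hsplit, hneg]
  simp only [surrogate, integral_const, probReal_univ, smul_eq_mul]
  ring

lemma hessian_apply_eq_sum (u : RR d → ℝ) (θ z : RR d) :
    iteratedFDeriv ℝ 2 u θ (fun _ => z) = ∑ i, ∑ j, z i * z j * hessian u θ i j := by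
  have hz : z = ∑ i, z i • EuclideanSpace.single i (1 : ℝ) := by
    simpa using ((EuclideanSpace.basisFun (Fin d) ℝ).sum_repr z).symm
  have h2 : ∀ x y : RR d, iteratedFDeriv ℝ 2 u θ ![x, y] = fderiv ℝ (fderiv ℝ u) θ x y := by
    intro x y; simp [iteratedFDeriv_two_apply]
  have hzz : (fun _ : Fin 2 => z) = ![z, z] := by ext i; fin_cases i <;> rfl
  rw [hzz, h2]
  conv_lhs => rw [hz]
  simp only [map_sum, map_smul, FunLike.coe_sum, Finset.sum_apply,
    FunLike.coe_smul, Pi.smul_apply, smul_eq_mul, hessian, Matrix.of_apply, h2]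
  simp only [Finset.mul_sum]
  rw [Finset.sum_comm]
  exact Finset.sum_congr rfl fun _ _ => Finset.sum_congr rfl fun _ _ => by ring

lemma integrable_hessian_apply (u : RR d → ℝ) (σ : ℝ) (θ : RR d) :
    Integrable (fun z => iteratedFDeriv ℝ 2 u θ (fun _ => z)) (noiseLaw d σ) := by
  simp only [hessian_apply_eq_sum]
  exact integrable_finsetSum _ fun i _ => integrable_finsetSum _ fun j _ =>
    (integrable_coord_mul_noiseLaw d σ i j).mul_const _

/-- The expectation of the quadratic form of the Hessian at the noise is `σ² tr H(θ)`. -/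
lemma flatObjective_sub_eq (u : RR d → ℝ) (σ : ℝ) (θ : RR d) :
    flatObjective u σ θ - u θ =
      (∫ z, iteratedFDeriv ℝ 2 u θ (fun _ => z) ∂(noiseLaw d σ)) / 2 := by
  have hint : ∀ i j, Integrable (fun z : RR d => z i * z j * hessian u θ i j) (noiseLaw d σ) :=
    fun i j => (integrable_coord_mul_noiseLaw d σ i j).mul_const _
  have h : ∫ z : RR d, ∑ i, ∑ j, z i * z j * hessian u θ i j ∂(noiseLaw d σ) =
      ∑ i, ∑ j, (if i = j then σ ^ 2 else 0) * hessian u θ i j := by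
    rw [integral_finsetSum _ fun i _ => integrable_finsetSum _ fun j _ => hint i j]
    refine Finset.sum_congr rfl fun i _ => ?_
    rw [integral_finsetSum _ fun j _ => hint i j]
    refine Finset.sum_congr rfl fun j _ => ?_
    rw [integral_mul_const, integral_coord_mul_noiseLaw]
  simp only [hessian_apply_eq_sum]
  rw [h]
  simp only [ite_mul, zero_mul, Finset.sum_ite_eq, Finset.mem_univ, if_true, flatObjective,
    Matrix.trace, Matrix.diag, ← Finset.mul_sum]
  ring

lemma integrable_second_difference (hint : ∀ θ, Integrable (fun z => u (θ + z)) (noiseLaw d σ))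
    (θ : RR d) : Integrable (fun z => u (θ + z) + u (θ - z) - 2 * u θ) (noiseLaw d σ) := by
  have hmp : MeasurePreserving (fun z : RR d => -z) (noiseLaw d σ) (noiseLaw d σ) :=
    ⟨by fun_prop, map_neg_noiseLaw d σ⟩
  have hint' : Integrable (fun z => u (θ - z)) (noiseLaw d σ) := by
    simpa [Function.comp_def, ← sub_eq_add_neg] using
      (hmp.integrable_comp_emb (Homeomorph.neg (RR d)).measurableEmbedding).2 (hint θ)
  exact ((hint θ).add hint').sub (integrable_const _)

lemma abs_surrogate_sub_le (hint : ∀ θ, Integrable (fun z => u (θ + z)) (noiseLaw d σ))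
    (hL : ∀ θ z, |u (θ + z) + u (θ - z) - 2 * u θ| ≤ L * ‖z‖ ^ 2) (θ : RR d) :
    |surrogate u σ θ - u θ| ≤ L * σ ^ 2 * ∫ z, ‖z‖ ^ 2 ∂(stdGaussian (RR d)) := by
  rw [surrogate_sub_eq hint, abs_div, abs_two]
  have h := norm_integral_le_of_norm_le ((integrable_norm_pow_noiseLaw d σ 2).const_mul L)
    (ae_of_all _ fun z => (Real.norm_eq_abs _).trans_le (hL θ z))
  rw [integral_const_mul, integral_norm_pow_noiseLaw, sq_abs, ← mul_assoc] at h
  rw [Real.norm_eq_abs] at h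
  linarith [(abs_nonneg _).trans h]

lemma abs_flatObjective_sub_le (hu : ContDiff ℝ 4 u)
    (hL : ∀ θ z, |u (θ + z) + u (θ - z) - 2 * u θ| ≤ L * ‖z‖ ^ 2) (σ : ℝ) (θ : RR d) :
    |flatObjective u σ θ - u θ| ≤ L * σ ^ 2 * ∫ z, ‖z‖ ^ 2 ∂(stdGaussian (RR d)) := by
  rw [flatObjective_sub_eq, abs_div, abs_two]
  have h := norm_integral_le_of_norm_le ((integrable_norm_pow_noiseLaw d σ 2).const_mul L)
    (ae_of_all _ fun z => (Real.norm_eq_abs _).trans_le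
      (abs_hessian_apply_le hu hL θ z))
  rw [integral_const_mul, integral_norm_pow_noiseLaw, sq_abs, ← mul_assoc] at h
  rw [Real.norm_eq_abs] at h
  linarith [(abs_nonneg _).trans h]

/-- Locally uniformly, surrogate and regularized objective differ by `O(σ⁴)`. -/
lemma exists_abs_flatObjective_sub_surrogate_le (hu : ContDiff ℝ 4 u)
    (hL : ∀ θ z, |u (θ + z) + u (θ - z) - 2 * u θ| ≤ L * ‖z‖ ^ 2) (hL0 : 0 ≤ L)
    (hint : ∀ σ θ, Integrable (fun z => u (θ + z)) (noiseLaw d σ)) (R : ℝ) :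
    ∃ K, 0 ≤ K ∧ ∀ σ, ∀ θ ∈ Metric.closedBall (0 : RR d) R,
      |flatObjective u σ θ - surrogate u σ θ| ≤ K * σ ^ 4 := by
  obtain ⟨C, hC0, hC⟩ := exists_second_difference_sub_le hu hL hL0 R
  refine ⟨C * ∫ z, ‖z‖ ^ 4 ∂(stdGaussian (RR d)), by positivity, fun σ θ hθ => ?_⟩
  have heq : flatObjective u σ θ - surrogate u σ θ =
      -((∫ z, (u (θ + z) + u (θ - z) - 2 * u θ - iteratedFDeriv ℝ 2 u θ (fun _ => z))
        ∂(noiseLaw d σ)) / 2) := by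
    rw [integral_sub (integrable_second_difference (hint σ) θ) (integrable_hessian_apply u σ θ)]
    linarith [flatObjective_sub_eq u σ θ, surrogate_sub_eq (hint σ) θ]
  rw [heq, abs_neg, abs_div, abs_two]
  have h := norm_integral_le_of_norm_le ((integrable_norm_pow_noiseLaw d σ 4).const_mul C)
    (ae_of_all _ fun z => (Real.norm_eq_abs _).trans_le (hC θ hθ z))
  rw [integral_const_mul, integral_norm_pow_noiseLaw, Even.pow_abs (by decide), Real.norm_eq_abs]
    at h
  linarith [(abs_nonneg _).trans h]

lemma measurable_surrogate (hu : Continuous u) (σ : ℝ) : Measurable (surrogate u σ) := by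
  have : StronglyMeasurable (Function.uncurry fun θ z : RR d => u (θ + z)) := by
    apply Continuous.stronglyMeasurable
    simp only [Function.uncurry_def]
    fun_prop
  exact this.integral_prod_right.measurable

lemma measurable_flatObjective (hu : ContDiff ℝ 4 u) (σ : ℝ) : Measurable (flatObjective u σ) := by
  have h2 : Continuous (iteratedFDeriv ℝ 2 u) := hu.continuous_iteratedFDeriv (by norm_num)
  have h1 : Continuous u := hu.continuous
  unfold flatObjective hessian
  simp only [Matrix.trace, Matrix.diag, Matrix.of_apply]
  fun_prop

end Surrogate

/-! ### Regularity and growth of the population objective -/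

lemma abs_sub_sub_inner_gradient_le {E : Type*} [NormedAddCommGroup E] [InnerProductSpace ℝ E]
    [CompleteSpace E] {f : E → ℝ} (hf : Differentiable ℝ f) {ℓ : ℝ} (hℓ : 0 ≤ ℓ)
    (hlip : ∀ θ θ', ‖gradient f θ - gradient f θ'‖ ≤ ℓ * ‖θ - θ'‖) (θ z : E) :
    |f (θ + z) - f θ - inner ℝ (gradient f θ) z| ≤ ℓ * ‖z‖ ^ 2 := by
  have h := (convex_closedBall θ ‖z‖).norm_image_sub_le_of_norm_hasFDerivWithin_le'
    (f := f) (f' := fun x => InnerProductSpace.toDual ℝ E (gradient f x))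
    (φ := InnerProductSpace.toDual ℝ E (gradient f θ)) (C := ℓ * ‖z‖) (x := θ) (y := θ + z)
    (fun x _ => (hf x).hasGradientAt.hasFDerivAt.hasFDerivWithinAt)
    (fun x hx => by
      rw [← map_sub, LinearIsometryEquiv.norm_map]
      refine (hlip x θ).trans ?_
      gcongr
      rwa [← dist_eq_norm])
    (by simp) (by simp)
  rw [add_sub_cancel_left, InnerProductSpace.toDual_apply_apply, Real.norm_eq_abs] at h
  calc _ ≤ ℓ * ‖z‖ * ‖z‖ := h
    _ = _ := by ring

section Objective

variable {Ω : Type*} [MeasurableSpace Ω] {P : Measure Ω}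
  {d m : ℕ} {U : RR d → RR m → ℝ} {X : Ω → RR m}

/-- The first-order expansion of `U` at each sample, with an integrable random constant. Only the
Lipschitz bound in `θ` enters. -/
lemma exists_integrable_expansion_bound (hUdiff : ∀ x, Differentiable ℝ fun θ => U θ x)
    (hLip : LipschitzAssumption P U X) :
    ∃ Y : Ω → ℝ, Integrable Y P ∧ (∀ ω, 0 ≤ Y ω) ∧ ∀ ω θ z,
      |U (θ + z) (X ω) - U θ (X ω) - inner ℝ (gradient (fun t => U t (X ω)) θ) z| ≤
        Y ω * ‖z‖ ^ 2 := by
  obtain ⟨φ, L₁, L₂, hL₁, -, hφ, hint, hθ, -⟩ := hLip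
  -- `φ ∘ X` need not be measurable; the integrable fourth power dominates it.
  refine ⟨fun ω => L₁ * |(1 + ‖X ω‖) * φ (X ω)| ^ 4, hint.const_mul _, fun ω => by positivity,
    fun ω θ z => ?_⟩
  have hφ1 := hφ (X ω)
  refine (abs_sub_sub_inner_gradient_le (hUdiff (X ω)) (by positivity) (hθ (X ω)) θ z).trans ?_
  have h1 : φ (X ω) ≤ |(1 + ‖X ω‖) * φ (X ω)| := by
    refine le_trans ?_ (le_abs_self _)
    exact le_mul_of_one_le_left (by linarith) (by linarith [norm_nonneg (X ω)])
  refine mul_le_mul_of_nonneg_right ?_ (sq_nonneg _)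
  exact mul_le_mul_of_nonneg_left (h1.trans (le_self_pow₀ (hφ1.trans h1) four_ne_zero)) hL₁.le

/-- Second differences of the objective are bounded quadratically. -/
lemma exists_objective_second_difference_le (hUdiff : ∀ x, Differentiable ℝ fun θ => U θ x)
    (hUint : ∀ θ, Integrable (fun ω => U θ (X ω)) P) (hLip : LipschitzAssumption P U X) :
    ∃ L, 0 ≤ L ∧ ∀ θ z, |objective P U X (θ + z) + objective P U X (θ - z) -
      2 * objective P U X θ| ≤ L * ‖z‖ ^ 2 := by
  obtain ⟨Y, hY, hY0, hYb⟩ := exists_integrable_expansion_bound hUdiff hLip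
  refine ⟨2 * ∫ ω, Y ω ∂P, mul_nonneg zero_le_two (integral_nonneg hY0), fun θ z => ?_⟩
  have heq : objective P U X (θ + z) + objective P U X (θ - z) - 2 * objective P U X θ =
      ∫ ω, ((U (θ + z) (X ω) + U (θ - z) (X ω)) - 2 * U θ (X ω)) ∂P := by
    have hsum : Integrable (fun ω => U (θ + z) (X ω) + U (θ - z) (X ω)) P :=
      (hUint _).add (hUint _)
    rw [integral_sub hsum ((hUint θ).const_mul 2),
      integral_add (hUint _) (hUint _), integral_const_mul]
    rfl
  rw [heq, ← Real.norm_eq_abs]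
  refine (norm_integral_le_of_norm_le ((hY.const_mul 2).mul_const (‖z‖ ^ 2))
    (ae_of_all _ fun ω => ?_)).trans_eq (by rw [integral_mul_const, integral_const_mul])
  have h1 := hYb ω θ z
  have h2 := hYb ω θ (-z)
  rw [inner_neg_right, norm_neg, ← sub_eq_add_neg] at h2
  rw [Real.norm_eq_abs]
  rw [abs_le] at h1 h2 ⊢
  constructor <;> linarith

lemma inner_toEuclideanLin_eq_sum (M : Matrix (Fin d) (Fin d) ℝ) (y : RR d) :
    inner ℝ y (M.toEuclideanLin y) = ∑ i, ∑ j, y i * M i j * y j := by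
  rw [PiLp.inner_apply]
  refine Finset.sum_congr rfl fun i _ => ?_
  simp only [Matrix.toLpLin_apply, Matrix.mulVec, dotProduct, RCLike.inner_apply, conj_trivial,
    Finset.sum_mul]
  exact Finset.sum_congr rfl fun j _ => by ring

/-- A symmetric matrix dominates its least eigenvalue as a quadratic form. -/
lemma le_inner_toEuclideanLin_of_isLeast {M : Matrix (Fin d) (Fin d) ℝ} (hM : M.IsSymm) {a : ℝ}
    (ha : IsLeast {μ : ℝ | Module.End.HasEigenvalue (Matrix.toLin' M) μ} a) (y : RR d) :
    a * ‖y‖ ^ 2 ≤ inner ℝ y (M.toEuclideanLin y) := by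
  have hsub : (M - a • (1 : Matrix (Fin d) (Fin d) ℝ)).IsHermitian := by
    rw [Matrix.IsHermitian, Matrix.conjTranspose_eq_transpose_of_trivial, Matrix.transpose_sub,
      Matrix.transpose_smul, Matrix.transpose_one, hM.eq]
  have hpos : (M - a • (1 : Matrix (Fin d) (Fin d) ℝ)).PosSemidef := by
    rw [hsub.posSemidef_iff_eigenvalues_nonneg]
    intro i
    have hmul := hsub.mulVec_eigenvectorBasis i
    have hne : (hsub.eigenvectorBasis i).ofLp ≠ 0 := by
      intro h0
      have := hsub.eigenvectorBasis.orthonormal.ne_zero i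
      exact this (by ext k; exact congrFun h0 k)
    have : a ≤ hsub.eigenvalues i + a := by
      refine ha.2 (Module.End.hasEigenvalue_of_hasEigenvector
        (x := (hsub.eigenvectorBasis i).ofLp) ⟨Module.End.mem_eigenspace_iff.2 ?_, hne⟩)
      rw [Matrix.sub_mulVec, Matrix.smul_mulVec, Matrix.one_mulVec, sub_eq_iff_eq_add] at hmul
      rw [Matrix.toLin'_apply, hmul, add_smul]
    simpa using this
  have h := hpos.re_dotProduct_nonneg y.ofLp
  rw [Matrix.sub_mulVec, Matrix.smul_mulVec, Matrix.one_mulVec, dotProduct_sub,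
    dotProduct_smul] at h
  have h1 : inner ℝ y (M.toEuclideanLin y) = star y.ofLp ⬝ᵥ M.mulVec y.ofLp := by
    rw [inner_toEuclideanLin_eq_sum]
    simp [dotProduct, Matrix.mulVec, Finset.mul_sum, mul_assoc]
  have h2 : ‖y‖ ^ 2 = star y.ofLp ⬝ᵥ y.ofLp := by
    rw [EuclideanSpace.real_norm_sq_eq]
    simp [dotProduct, pow_two]
  rw [h1, h2]
  simpa using h

/-- The dissipativity of the stochastic gradient passes to the objective. The gradient is never
integrated: the expansion of `U` along the ray through `θ` is, before the limit is taken. -/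
lemma exists_objective_dissipative (hUdiff : ∀ x, Differentiable ℝ fun θ => U θ x)
    (hUint : ∀ θ, Integrable (fun ω => U θ (X ω)) P) (hLip : LipschitzAssumption P U X)
    (hDiss : DissipativityAssumption P U X) (hu : Differentiable ℝ (objective P U X)) :
    ∃ a b, 0 < a ∧ ∀ θ, a * ‖θ‖ ^ 2 - b ≤ fderiv ℝ (objective P U X) θ θ := by
  obtain ⟨Y, hY, hY0, hYb⟩ := exists_integrable_expansion_bound hUdiff hLip
  obtain ⟨A, b, -, -, hsymm, -, hdiss, hAint, hbint, ⟨a, ha, hleast⟩, -⟩ := hDiss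
  refine ⟨a, ∫ ω, b (X ω) ∂P, ha, fun θ => ?_⟩
  have hquad : ∀ ω, inner ℝ θ ((A (X ω)).toEuclideanLin θ) =
      ∑ i, ∑ j, θ i * A (X ω) i j * θ j := fun ω => inner_toEuclideanLin_eq_sum _ _
  have hterm : ∀ i j, Integrable (fun ω => θ i * A (X ω) i j * θ j) P := fun i j =>
    ((hAint i j).const_mul _).mul_const _
  have hquadint : Integrable (fun ω => inner ℝ θ ((A (X ω)).toEuclideanLin θ)) P := by
    simp only [hquad]
    exact integrable_finsetSum _ fun i _ => integrable_finsetSum _ fun j _ => hterm i j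
  have hlow : a * ‖θ‖ ^ 2 ≤ ∫ ω, inner ℝ θ ((A (X ω)).toEuclideanLin θ) ∂P := by
    have hsymm' : (Matrix.of fun i j => ∫ ω, A (X ω) i j ∂P).IsSymm := by
      ext i j
      simp only [Matrix.transpose_apply, Matrix.of_apply]
      exact integral_congr_ae (ae_of_all _ fun ω => (hsymm (X ω)).apply i j)
    refine (le_inner_toEuclideanLin_of_isLeast hsymm' hleast θ).trans_eq ?_
    simp only [hquad]
    rw [inner_toEuclideanLin_eq_sum,
      integral_finsetSum _ fun i _ => integrable_finsetSum _ fun j _ => hterm i j]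
    refine Finset.sum_congr rfl fun i _ => ?_
    rw [integral_finsetSum _ fun j _ => hterm i j]
    refine Finset.sum_congr rfl fun j _ => ?_
    rw [integral_mul_const, integral_const_mul, Matrix.of_apply]
  have hgap : Integrable (fun ω => inner ℝ θ ((A (X ω)).toEuclideanLin θ) - b (X ω)) P :=
    hquadint.sub hbint
  -- The integrated expansion along the ray.
  have hstep : ∀ s : ℝ, 0 < s →
      a * ‖θ‖ ^ 2 - ∫ ω, b (X ω) ∂P - s * ((∫ ω, Y ω ∂P) * ‖θ‖ ^ 2) ≤
        s⁻¹ • (objective P U X (θ + s • θ) - objective P U X θ) := by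
    intro s hs
    have hmono : ∫ ω, (s * (inner ℝ θ ((A (X ω)).toEuclideanLin θ) - b (X ω)) -
        s ^ 2 * ‖θ‖ ^ 2 * Y ω) ∂P ≤ ∫ ω, (U (θ + s • θ) (X ω) - U θ (X ω)) ∂P := by
      refine integral_mono ((hgap.const_mul s).sub (hY.const_mul _))
        ((hUint _).sub (hUint _)) fun ω => ?_
      have h1 := (abs_le.1 (hYb ω θ (s • θ))).1
      rw [inner_smul_right, norm_smul, mul_pow, Real.norm_eq_abs, sq_abs] at h1
      have h2 := mul_le_mul_of_nonneg_left (hdiss (X ω) θ) hs.le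
      simp only
      linarith
    rw [integral_sub (hgap.const_mul s) (hY.const_mul _), integral_const_mul,
      integral_const_mul, integral_sub hquadint hbint, integral_sub (hUint _) (hUint _)] at hmono
    rw [smul_eq_mul, inv_mul_eq_div, le_div_iff₀ hs]
    have h3 := mul_le_mul_of_nonneg_left hlow hs.le
    unfold objective
    linarith
  have hderiv : HasDerivAt (fun s : ℝ => objective P U X (θ + s • θ))
      (fderiv ℝ (objective P U X) θ θ) 0 := by
    have hline : HasDerivAt (fun s : ℝ => θ + s • θ) θ 0 := by
      simpa using ((hasDerivAt_id (0 : ℝ)).smul_const θ).const_add θ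
    have hf : HasFDerivAt (objective P U X) (fderiv ℝ (objective P U X) θ) (θ + (0 : ℝ) • θ) := by
      simpa using (hu θ).hasFDerivAt
    exact hf.comp_hasDerivAt 0 hline
  have hlim := hderiv.tendsto_slope_zero_right
  simp only [zero_add, zero_smul, add_zero] at hlim
  have hlim' : Tendsto (fun s : ℝ => a * ‖θ‖ ^ 2 - ∫ ω, b (X ω) ∂P -
      s * ((∫ ω, Y ω ∂P) * ‖θ‖ ^ 2)) (𝓝[>] 0) (𝓝 (a * ‖θ‖ ^ 2 - ∫ ω, b (X ω) ∂P)) := by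
    refine tendsto_nhdsWithin_of_tendsto_nhds ?_
    have : ContinuousAt (fun s : ℝ => a * ‖θ‖ ^ 2 - ∫ ω, b (X ω) ∂P -
      s * ((∫ ω, Y ω ∂P) * ‖θ‖ ^ 2)) 0 := by fun_prop
    simpa [ContinuousAt] using this
  refine le_of_tendsto_of_tendsto hlim' hlim ?_
  filter_upwards [self_mem_nhdsWithin] with s hs using hstep s hs

end Objective

/-- Integrating the dissipativity inequality along rays from the unit ball gives quadratic
growth. -/
lemma exists_quadratic_lower_bound {d : ℕ} {u : RR d → ℝ} (hu : Differentiable ℝ u) {a b : ℝ}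
    (ha : 0 < a) (hdiss : ∀ θ, a * ‖θ‖ ^ 2 - b ≤ fderiv ℝ u θ θ) :
    ∃ C, ∀ θ, a / 4 * ‖θ‖ ^ 2 - C ≤ u θ := by
  obtain ⟨m, hm⟩ := (isCompact_closedBall (0 : RR d) 1).exists_bound_of_continuousOn
    hu.continuous.continuousOn
  have hm' : ∀ θ : RR d, ‖θ‖ ≤ 1 → -m ≤ u θ := fun θ hθ =>
    neg_le_of_abs_le (hm θ (by simpa using hθ))
  refine ⟨m + a / 2 + |b| + b ^ 2 / a, fun θ => ?_⟩
  have hb2 : 0 ≤ b ^ 2 / a := by positivity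
  rcases le_total ‖θ‖ 1 with hθ | hθ
  · have h1 := hm' θ hθ
    have h2 : ‖θ‖ ^ 2 ≤ 1 := pow_le_one₀ (norm_nonneg _) hθ
    have h3 := mul_le_mul_of_nonneg_left h2 ha.le
    linarith [abs_nonneg b]
  · set r := ‖θ‖ with hr
    have hr0 : 0 < r := by linarith
    set w := r⁻¹ • θ with hw
    have hwn : ‖w‖ = 1 := by
      rw [hw, norm_smul, norm_inv, norm_norm, ← hr, inv_mul_cancel₀ hr0.ne']
    have hderiv : ∀ t : ℝ, HasDerivAt (fun t : ℝ => u (t • w) - a / 2 * t ^ 2 + |b| * t)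
        (fderiv ℝ u (t • w) w - a * t + |b|) t := by
      intro t
      have hline : HasDerivAt (fun t : ℝ => t • w) w t := by
        simpa using (hasDerivAt_id t).smul_const w
      have h1 := (hu (t • w)).hasFDerivAt.comp_hasDerivAt t hline
      have h2 : HasDerivAt (fun t : ℝ => a / 2 * t ^ 2) (a * t) t := by
        refine ((hasDerivAt_pow 2 t).const_mul (a / 2)).congr_deriv ?_
        norm_num
        ring
      have h3 : HasDerivAt (fun t : ℝ => |b| * t) |b| t := by
        simpa using (hasDerivAt_id t).const_mul |b|
      exact (h1.sub h2).add h3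
    have hmono : MonotoneOn (fun t : ℝ => u (t • w) - a / 2 * t ^ 2 + |b| * t) (Set.Ici 1) := by
      refine monotoneOn_of_deriv_nonneg (convex_Ici 1)
        (fun t _ => (hderiv t).continuousAt.continuousWithinAt)
        (fun t _ => (hderiv t).differentiableAt.differentiableWithinAt) fun t ht => ?_
      rw [interior_Ici, Set.mem_Ioi] at ht
      rw [(hderiv t).deriv]
      have h1 := hdiss (t • w)
      rw [map_smul, norm_smul, hwn, mul_one, Real.norm_eq_abs, sq_abs, smul_eq_mul] at h1
      have h2 : b ≤ t * |b| := (le_abs_self b).trans (le_mul_of_one_le_left (abs_nonneg b) ht.le)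
      have h3 : 0 ≤ t * (fderiv ℝ u (t • w) w - a * t + |b|) := by linarith
      exact nonneg_of_mul_nonneg_right h3 (by linarith)
    have h1 := hmono (Set.mem_Ici.2 le_rfl) (Set.mem_Ici.2 hθ) hθ
    have h2 : r • w = θ := by rw [hw, smul_smul, mul_inv_cancel₀ hr0.ne', one_smul]
    simp only [one_smul, h2] at h1
    have h3 := hm' w hwn.le
    -- Completing the square absorbs the linear term.
    have h4 : |b| * r ≤ a / 4 * r ^ 2 + b ^ 2 / a := by
      have : a / 4 * r ^ 2 + b ^ 2 / a - |b| * r = (a / 2 * r - |b|) ^ 2 / a := by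
        rw [← sq_abs b]
        field_simp
        ring
      have : 0 ≤ (a / 2 * r - |b|) ^ 2 / a := by positivity
      linarith
    linarith [abs_nonneg b]

/-! ### Concentration of Gibbs measures -/

lemma integrable_exp_neg_mul_norm_sq (d : ℕ) {c : ℝ} (hc : 0 < c) :
    Integrable (fun x : RR d => Real.exp (-(c * ‖x‖ ^ 2))) := by
  have h := (GaussianFourier.integrable_cexp_neg_mul_sq_norm_add (V := RR d) (b := (c : ℂ))
    (by simpa using hc) 0 0).norm
  refine h.congr (ae_of_all _ fun x => ?_)
  simp only [Complex.norm_exp]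
  congr 1
  simp [← Complex.ofReal_pow]

lemma integrable_one_add_norm_sq_mul_exp (d : ℕ) {c : ℝ} (hc : 0 < c) :
    Integrable (fun x : RR d => (1 + ‖x‖ ^ 2) * Real.exp (-(c * ‖x‖ ^ 2))) := by
  refine ((integrable_exp_neg_mul_norm_sq d (half_pos hc)).const_mul (1 + 2 / c)).mono'
    (by fun_prop) (ae_of_all _ fun x => ?_)
  rw [Real.norm_eq_abs, abs_of_nonneg (by positivity)]
  -- Half of the exponent absorbs the polynomial weight, by `1 + t ≤ exp t`.
  have h1 : 1 + ‖x‖ ^ 2 ≤ (1 + 2 / c) * Real.exp (c / 2 * ‖x‖ ^ 2) := by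
    have h2 := Real.add_one_le_exp (c / 2 * ‖x‖ ^ 2)
    calc 1 + ‖x‖ ^ 2 ≤ (1 + 2 / c) * (c / 2 * ‖x‖ ^ 2 + 1) := by
          have : (1 + 2 / c) * (c / 2 * ‖x‖ ^ 2 + 1) =
              1 + ‖x‖ ^ 2 + (c / 2 * ‖x‖ ^ 2 + 2 / c) := by
            field_simp
            ring
          have : 0 ≤ c / 2 * ‖x‖ ^ 2 + 2 / c := by positivity
          linarith
      _ ≤ _ := by gcongr
  calc _ ≤ (1 + 2 / c) * Real.exp (c / 2 * ‖x‖ ^ 2) * Real.exp (-(c * ‖x‖ ^ 2)) := by gcongr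
    _ = _ := by
      rw [mul_assoc, ← Real.exp_add]
      congr 2
      ring

lemma integrable_exp_neg_of_quadratic_growth {d : ℕ} {f : RR d → ℝ} (hf : Measurable f)
    {c C β : ℝ} (hc : 0 < c) (hβ : 0 < β) (hlow : ∀ x, c * ‖x‖ ^ 2 - C ≤ f x) :
    Integrable (fun x => Real.exp (-β * f x)) := by
  refine ((integrable_exp_neg_mul_norm_sq d (mul_pos hβ hc)).const_mul (Real.exp (β * C))).mono'
    (by fun_prop) (ae_of_all _ fun x => ?_)
  rw [Real.norm_eq_abs, Real.abs_exp, ← Real.exp_add]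
  apply Real.exp_le_exp.2
  have := mul_le_mul_of_nonneg_left (hlow x) hβ.le
  linarith

lemma isProbabilityMeasure_gibbs {d : ℕ} {f : RR d → ℝ} (hf : Measurable f)
    {c C β : ℝ} (hc : 0 < c) (hβ : 0 < β) (hlow : ∀ x, c * ‖x‖ ^ 2 - C ≤ f x) :
    IsProbabilityMeasure (gibbs β f) :=
  isProbabilityMeasure_tilted (integrable_exp_neg_of_quadratic_growth hf hc hβ hlow)

/-- Uniformly over potentials with a given quadratic lower bound and a given upper bound on the unit
ball, the mass and second moment of the Gibbs measure outside a large ball decay exponentially in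
`β`. The radius makes the potential there exceed its values on the unit ball by `1`. -/
lemma exists_gibbs_tail_le (d : ℕ) {c : ℝ} (hc : 0 < c) (C₁ C₂ : ℝ) :
    ∃ R K : ℝ, 0 ≤ K ∧ ∀ β, 1 ≤ β → ∀ f : RR d → ℝ, Measurable f →
      (∀ x, c * ‖x‖ ^ 2 - C₁ ≤ f x) → (∀ x ∈ Metric.closedBall 0 1, f x ≤ C₂) →
      ∫⁻ x in (Metric.closedBall 0 R)ᶜ, ENNReal.ofReal (1 + ‖x‖ ^ 2) ∂(gibbs β f) ≤
        ENNReal.ofReal (K * Real.exp (-β)) := by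
  set R := Real.sqrt (|C₁ + C₂ + 1| / c) with hR
  set V := (volume : Measure (RR d)).real (Metric.closedBall 0 1) with hV
  have hVpos : 0 < V := by
    rw [hV, measureReal_def]
    exact ENNReal.toReal_pos (Metric.measure_closedBall_pos _ _ one_pos).ne'
      measure_closedBall_lt_top.ne
  set I := ∫ x : RR d, (1 + ‖x‖ ^ 2) * Real.exp (-(c * ‖x‖ ^ 2)) with hI
  have hI0 : 0 ≤ I := integral_nonneg fun x => by positivity
  set B := Real.exp (C₁ + C₂ + 1) / V with hB
  have hB0 : 0 ≤ B := by positivity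
  refine ⟨R, B * I, by positivity, fun β hβ f hf hlow hup => ?_⟩
  have hint := integrable_exp_neg_of_quadratic_growth hf hc (by linarith : 0 < β) hlow
  set Z := ∫ x : RR d, Real.exp (-β * f x) with hZ
  have hZlow : Real.exp (-β * C₂) * V ≤ Z := by
    calc Real.exp (-β * C₂) * V
        = ∫ x in Metric.closedBall (0 : RR d) 1, Real.exp (-β * C₂) := by
          rw [setIntegral_const, smul_eq_mul, mul_comm]
      _ ≤ ∫ x in Metric.closedBall (0 : RR d) 1, Real.exp (-β * f x) := by
          refine setIntegral_mono_on (integrableOn_const measure_closedBall_lt_top.ne)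
            hint.integrableOn Metric.isClosed_closedBall.measurableSet fun x hx => ?_
          apply Real.exp_le_exp.2
          have := mul_le_mul_of_nonneg_left (hup x hx) (by linarith : 0 ≤ β)
          linarith
      _ ≤ Z := setIntegral_le_integral hint (ae_of_all _ fun x => (Real.exp_pos _).le)
  have hZpos : 0 < Z := lt_of_lt_of_le (by positivity) hZlow
  have hpt : ∀ x ∈ (Metric.closedBall (0 : RR d) R)ᶜ,
      Real.exp (-β * f x) / Z * (1 + ‖x‖ ^ 2) ≤
        B * Real.exp (-β) * ((1 + ‖x‖ ^ 2) * Real.exp (-(c * ‖x‖ ^ 2))) := by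
    intro x hx
    have hxR : R < ‖x‖ := by simpa using hx
    have hsq : C₁ + C₂ + 1 ≤ c * ‖x‖ ^ 2 := by
      have h1 : |C₁ + C₂ + 1| / c ≤ ‖x‖ ^ 2 := by
        rw [← Real.sq_sqrt (by positivity : 0 ≤ |C₁ + C₂ + 1| / c)]
        exact pow_le_pow_left₀ (Real.sqrt_nonneg _) hxR.le 2
      rw [div_le_iff₀ hc] at h1
      linarith [le_abs_self (C₁ + C₂ + 1)]
    have h2 : Real.exp (-β * f x) / Z ≤ B * Real.exp (-β) * Real.exp (-(c * ‖x‖ ^ 2)) := by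
      rw [div_le_iff₀ hZpos]
      calc Real.exp (-β * f x)
          ≤ Real.exp (C₁ + C₂ + 1) * Real.exp (-β) * Real.exp (-(c * ‖x‖ ^ 2)) *
              Real.exp (-β * C₂) := by
            rw [← Real.exp_add, ← Real.exp_add, ← Real.exp_add]
            apply Real.exp_le_exp.2
            have h3 := mul_le_mul_of_nonneg_left (hlow x) (by linarith : 0 ≤ β)
            have h4 := mul_le_mul_of_nonneg_left hsq (by linarith : 0 ≤ β - 1)
            linarith
        _ = B * Real.exp (-β) * Real.exp (-(c * ‖x‖ ^ 2)) * (Real.exp (-β * C₂) * V) := by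
            rw [hB]
            field_simp
        _ ≤ _ := by gcongr
    calc _ ≤ B * Real.exp (-β) * Real.exp (-(c * ‖x‖ ^ 2)) * (1 + ‖x‖ ^ 2) := by gcongr
      _ = _ := by ring
  rw [gibbs, setLIntegral_tilted' _ _ Metric.isClosed_closedBall.measurableSet.compl]
  calc _ ≤ ∫⁻ x in (Metric.closedBall (0 : RR d) R)ᶜ, ENNReal.ofReal
          (B * Real.exp (-β) * ((1 + ‖x‖ ^ 2) * Real.exp (-(c * ‖x‖ ^ 2)))) := by
        refine setLIntegral_mono' Metric.isClosed_closedBall.measurableSet.compl fun x hx => ?_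
        rw [← ENNReal.ofReal_mul (by positivity)]
        exact ENNReal.ofReal_le_ofReal (hpt x hx)
    _ ≤ ∫⁻ x : RR d, ENNReal.ofReal
          (B * Real.exp (-β) * ((1 + ‖x‖ ^ 2) * Real.exp (-(c * ‖x‖ ^ 2)))) :=
        setLIntegral_le_lintegral _ _
    _ = ENNReal.ofReal (B * I * Real.exp (-β)) := by
        rw [← ofReal_integral_eq_lintegral_ofReal
          ((integrable_one_add_norm_sq_mul_exp d hc).const_mul _)
          (ae_of_all _ fun x => by positivity), integral_const_mul]
        congr 1
        ring

lemma measureReal_compl_le_of_tail {d : ℕ} {μ : Measure (RR d)} {s : Set (RR d)} {t : ℝ}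
    (ht : 0 ≤ t)
    (h : ∫⁻ x in sᶜ, ENNReal.ofReal (1 + ‖x‖ ^ 2) ∂μ ≤ ENNReal.ofReal t) : μ.real sᶜ ≤ t := by
  refine ENNReal.toReal_le_of_le_ofReal ht (le_trans ?_ h)
  rw [← setLIntegral_one]
  refine lintegral_mono fun x => ?_
  rw [ENNReal.one_le_ofReal]
  linarith [sq_nonneg ‖x‖]

lemma lintegral_enorm_sq_le_of_tail {d : ℕ} {μ : Measure (RR d)} {s : Set (RR d)} {t : ℝ}
    (h : ∫⁻ x in s, ENNReal.ofReal (1 + ‖x‖ ^ 2) ∂μ ≤ ENNReal.ofReal t) :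
    ∫⁻ x in s, ‖x‖ₑ ^ (2 : ℝ) ∂μ ≤ ENNReal.ofReal t := by
  refine (lintegral_mono fun x => ?_).trans h
  rw [← ofReal_norm, ENNReal.ofReal_rpow_of_nonneg (norm_nonneg _) zero_le_two, Real.rpow_two]
  exact ENNReal.ofReal_le_ofReal (by linarith)

/-! ### Convergence of the two Gibbs measures -/

section Convergence

variable {d : ℕ} {u : RR d → ℝ} {L c C : ℝ}

/-- Both potentials differ from `u` by `O(σ²)`, which preserves quadratic growth. -/
lemma exists_potential_bounds (hu : ContDiff ℝ 4 u)
    (hL : ∀ θ z, |u (θ + z) + u (θ - z) - 2 * u θ| ≤ L * ‖z‖ ^ 2) (hL0 : 0 ≤ L)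
    (hint : ∀ σ θ, Integrable (fun z => u (θ + z)) (noiseLaw d σ)) :
    ∃ G, 0 ≤ G ∧ ∀ σ θ, |surrogate u σ θ - u θ| ≤ G * σ ^ 2 ∧
      |flatObjective u σ θ - u θ| ≤ G * σ ^ 2 := by
  refine ⟨L * ∫ z, ‖z‖ ^ 2 ∂(stdGaussian (RR d)), by positivity, fun σ θ => ?_⟩
  rw [mul_right_comm]
  exact ⟨abs_surrogate_sub_le (hint σ) hL θ, abs_flatObjective_sub_le hu hL σ θ⟩

lemma piFSGLD_eq_tilted {σ β : ℝ}
    (hint : Integrable (fun θ => Real.exp (-β * flatObjective u σ θ))) :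
    piFSGLD u σ β =
      (piStar u σ β).tilted fun θ => β * (flatObjective u σ θ - surrogate u σ θ) := by
  rw [piFSGLD, piStar, gibbs, gibbs, tilted_tilted hint]
  congr 1
  ext θ
  simp only [Pi.add_apply]
  ring

/-- For `σ⁴ = o(1 / β)` the potentials `β g_ε` and `β v` are uniformly close on a fixed ball, while
their distance elsewhere is `O(β)` and is beaten by the exponentially small mass there. -/
lemma exists_tilted_bounds (hu : ContDiff ℝ 4 u)
    (hL : ∀ θ z, |u (θ + z) + u (θ - z) - 2 * u θ| ≤ L * ‖z‖ ^ 2) (hL0 : 0 ≤ L) (hc : 0 < c)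
    (hlow : ∀ θ, c * ‖θ‖ ^ 2 - C ≤ u θ) {η : ℝ} (hη : 0 < η) {σ : ℝ → ℝ}
    (hσ : ∀ β, 0 < β → σ β = β ^ (-(1 + η) / 4)) :
    ∃ R K M D : ℝ, 0 ≤ K ∧ 0 ≤ M ∧ 0 ≤ D ∧ ∀ β, 1 ≤ β →
      (∀ θ, |β * (flatObjective u (σ β) θ - surrogate u (σ β) θ)| ≤ D * β) ∧
      (∀ θ ∈ Metric.closedBall 0 R,
        |β * (flatObjective u (σ β) θ - surrogate u (σ β) θ)| ≤ M * β ^ (-η)) ∧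
      (∫⁻ x in (Metric.closedBall 0 R)ᶜ, ENNReal.ofReal (1 + ‖x‖ ^ 2) ∂(piFSGLD u (σ β) β) ≤
        ENNReal.ofReal (K * Real.exp (-β))) ∧
      ∫⁻ x in (Metric.closedBall 0 R)ᶜ, ENNReal.ofReal (1 + ‖x‖ ^ 2) ∂(piStar u (σ β) β) ≤
        ENNReal.ofReal (K * Real.exp (-β)) := by
  have hint : ∀ σ θ, Integrable (fun z => u (θ + z)) (noiseLaw d σ) := fun σ θ =>
    integrable_comp_add_noiseLaw hu.continuous hL
      (fun θ => (by linarith [hlow θ, mul_nonneg hc.le (sq_nonneg ‖θ‖)] : -C ≤ u θ)) σ θ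
  obtain ⟨G, hG0, hG⟩ := exists_potential_bounds hu hL hL0 hint
  obtain ⟨B, hB⟩ := (isCompact_closedBall (0 : RR d) 1).exists_bound_of_continuousOn
    hu.continuous.continuousOn
  obtain ⟨R, K, hK0, htail⟩ := exists_gibbs_tail_le d hc (C + G) (B + G)
  obtain ⟨M, hM0, hM⟩ := exists_abs_flatObjective_sub_surrogate_le hu hL hL0 hint R
  refine ⟨R, K, M, 2 * G, hK0, hM0, by positivity, fun β hβ => ?_⟩
  have hβ0 : 0 < β := by linarith
  have hσ0 : 0 ≤ σ β := by rw [hσ β hβ0]; positivity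
  have hσ1 : σ β ≤ 1 := by
    rw [hσ β hβ0]
    exact Real.rpow_le_one_of_one_le_of_nonpos hβ (by linarith)
  have hσ4 : β * σ β ^ 4 = β ^ (-η) := by
    rw [hσ β hβ0, ← Real.rpow_natCast, ← Real.rpow_mul hβ0.le]
    nth_rewrite 1 [← Real.rpow_one β]
    rw [← Real.rpow_add hβ0]
    congr 1
    push_cast
    ring
  have hGσ : G * σ β ^ 2 ≤ G := mul_le_of_le_one_right hG0 (pow_le_one₀ hσ0 hσ1)
  have hpot : ∀ f : RR d → ℝ, Measurable f → (∀ θ, |f θ - u θ| ≤ G * σ β ^ 2) →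
      ∫⁻ x in (Metric.closedBall 0 R)ᶜ, ENNReal.ofReal (1 + ‖x‖ ^ 2) ∂(gibbs β f) ≤
        ENNReal.ofReal (K * Real.exp (-β)) := by
    intro f hf hfu
    refine htail β hβ f hf (fun x => ?_) fun x hx => ?_
    · linarith [(abs_le.1 (hfu x)).1, hlow x]
    · linarith [(abs_le.1 (hfu x)).2, (abs_le.1 (hB x hx)).2]
  refine ⟨fun θ => ?_, fun θ hθ => ?_, hpot _ (measurable_surrogate hu.continuous _)
    fun θ => (hG _ θ).1, hpot _ (measurable_flatObjective hu _) fun θ => (hG _ θ).2⟩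
  · rw [abs_mul, abs_of_pos hβ0, mul_comm]
    gcongr
    have h1 := abs_le.1 ((hG (σ β) θ).1.trans hGσ)
    have h2 := abs_le.1 ((hG (σ β) θ).2.trans hGσ)
    rw [abs_le]
    constructor <;> linarith
  · rw [abs_mul, abs_of_pos hβ0, ← hσ4]
    calc _ ≤ β * (M * σ β ^ 4) := by gcongr; exact hM _ θ hθ
      _ = _ := by ring

lemma isProbabilityMeasure_piFSGLD (hu : ContDiff ℝ 4 u)
    (hL : ∀ θ z, |u (θ + z) + u (θ - z) - 2 * u θ| ≤ L * ‖z‖ ^ 2)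
    (hint : ∀ σ θ, Integrable (fun z => u (θ + z)) (noiseLaw d σ)) (hc : 0 < c)
    (hlow : ∀ θ, c * ‖θ‖ ^ 2 - C ≤ u θ) (σ : ℝ) {β : ℝ} (hβ : 0 < β) :
    IsProbabilityMeasure (piFSGLD u σ β) :=
  isProbabilityMeasure_gibbs (measurable_surrogate hu.continuous σ) hc hβ
    (C := C + L * σ ^ 2 * ∫ z, ‖z‖ ^ 2 ∂(stdGaussian (RR d))) fun θ => by
      linarith [hlow θ, (abs_le.1 (abs_surrogate_sub_le (hint σ) hL θ)).1]

lemma integrable_exp_flatObjective (hu : ContDiff ℝ 4 u)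
    (hL : ∀ θ z, |u (θ + z) + u (θ - z) - 2 * u θ| ≤ L * ‖z‖ ^ 2) (hc : 0 < c)
    (hlow : ∀ θ, c * ‖θ‖ ^ 2 - C ≤ u θ) (σ : ℝ) {β : ℝ} (hβ : 0 < β) :
    Integrable fun θ => Real.exp (-β * flatObjective u σ θ) :=
  integrable_exp_neg_of_quadratic_growth (measurable_flatObjective hu σ) hc hβ
    (C := C + L * σ ^ 2 * ∫ z, ‖z‖ ^ 2 ∂(stdGaussian (RR d))) fun θ => by
      linarith [hlow θ, (abs_le.1 (abs_flatObjective_sub_le hu hL σ θ)).1]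

/-- The analytic core, for a potential with quadratically bounded second differences and quadratic
growth. -/
lemma tendsto_klDiv_and_wasserstein (hu : ContDiff ℝ 4 u)
    (hL : ∀ θ z, |u (θ + z) + u (θ - z) - 2 * u θ| ≤ L * ‖z‖ ^ 2) (hL0 : 0 ≤ L) (hc : 0 < c)
    (hlow : ∀ θ, c * ‖θ‖ ^ 2 - C ≤ u θ) {η : ℝ} (hη : 0 < η) {σ : ℝ → ℝ}
    (hσ : ∀ β, 0 < β → σ β = β ^ (-(1 + η) / 4)) :
    Tendsto (fun β : ℝ => InformationTheory.klDiv (piFSGLD u (σ β) β) (piStar u (σ β) β))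
      atTop (𝓝 0) ∧
    Tendsto (fun β : ℝ => wasserstein 2 (piFSGLD u (σ β) β) (piStar u (σ β) β))
      atTop (𝓝 0) := by
  obtain ⟨R, K, M, D, hK0, hM0, hD0, hb⟩ := exists_tilted_bounds hu hL hL0 hc hlow hη hσ
  have hs : MeasurableSet (Metric.closedBall (0 : RR d) R) :=
    Metric.isClosed_closedBall.measurableSet
  have hF : ∀ σ β, Measurable fun θ => β * (flatObjective u σ θ - surrogate u σ θ) := fun σ β =>
    ((measurable_flatObjective hu σ).sub (measurable_surrogate hu.continuous σ)).const_mul β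
  have hint : ∀ {β : ℝ}, 1 ≤ β →
      Integrable fun θ => Real.exp (-β * flatObjective u (σ β) θ) := fun hβ =>
    integrable_exp_flatObjective hu hL hc hlow _ (by linarith)
  have hprob : ∀ {β : ℝ}, 1 ≤ β → IsProbabilityMeasure (piStar u (σ β) β) := fun hβ =>
    isProbabilityMeasure_tilted (hint hβ)
  have hprob' : ∀ {β : ℝ}, 1 ≤ β → IsProbabilityMeasure (piFSGLD u (σ β) β) := fun {β} hβ => by
    have := hprob hβ
    rw [piFSGLD_eq_tilted (hint hβ)]
    exact isProbabilityMeasure_tilted (integrable_exp_of_bound (hF _ _) (hb β hβ).1)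
  have hexp : Tendsto (fun β : ℝ => K * Real.exp (-β)) atTop (𝓝 0) := by
    simpa using (Real.tendsto_exp_neg_atTop_nhds_zero).const_mul K
  have hδ : Tendsto (fun β : ℝ => M * β ^ (-η)) atTop (𝓝 0) := by
    simpa using (tendsto_rpow_neg_atTop hη).const_mul M
  constructor
  · have hlim : Tendsto (fun β : ℝ => ENNReal.ofReal (2 * (M * β ^ (-η)) +
        D * β * (K * Real.exp (-β) + K * Real.exp (-β)))) atTop (𝓝 0) := by
      have h1 : Tendsto (fun β : ℝ => β * Real.exp (-β)) atTop (𝓝 0) := by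
        simpa using Real.tendsto_pow_mul_exp_neg_atTop_nhds_zero 1
      have h2 := (hδ.const_mul 2).add (h1.const_mul (2 * D * K))
      rw [mul_zero, mul_zero, add_zero] at h2
      rw [← ENNReal.ofReal_zero]
      refine ENNReal.tendsto_ofReal (h2.congr fun β => ?_)
      ring
    refine tendsto_of_tendsto_of_tendsto_of_le_of_le' tendsto_const_nhds hlim
      (Eventually.of_forall fun _ => zero_le) ?_
    filter_upwards [eventually_ge_atTop 1] with β hβ
    obtain ⟨hD, hball, ht1, ht2⟩ := hb β hβ
    have hβ0 : 0 ≤ β := by linarith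
    have := hprob hβ
    have h1 := measureReal_compl_le_of_tail (by positivity) ht1
    have h2 := measureReal_compl_le_of_tail (by positivity) ht2
    rw [piFSGLD_eq_tilted (hint hβ)] at h1 ⊢
    refine (klDiv_tilted_le hs (hF _ _) (by positivity) hD hball).trans ?_
    gcongr
  · -- The masses of the ball under both measures tend to `1`.
    have hmass : ∀ τ : ℝ → Measure (RR d), (∀ β, 1 ≤ β → IsProbabilityMeasure (τ β)) →
        (∀ β, 1 ≤ β → ∫⁻ x in (Metric.closedBall 0 R)ᶜ, ENNReal.ofReal (1 + ‖x‖ ^ 2) ∂(τ β) ≤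
          ENNReal.ofReal (K * Real.exp (-β))) →
        Tendsto (fun β => (τ β).real (Metric.closedBall 0 R)) atTop (𝓝 1) := by
      intro τ hτ ht
      have h1 : Tendsto (fun β : ℝ => 1 - K * Real.exp (-β)) atTop (𝓝 1) := by
        simpa using hexp.const_sub 1
      refine tendsto_of_tendsto_of_tendsto_of_le_of_le' h1 tendsto_const_nhds ?_ ?_
      · filter_upwards [eventually_ge_atTop 1] with β hβ
        have := hτ β hβ
        have h2 := measureReal_compl_le_of_tail (by positivity) (ht β hβ)
        rw [probReal_compl_eq_one_sub hs] at h2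
        linarith
      · filter_upwards [eventually_ge_atTop 1] with β hβ
        have := hτ β hβ
        exact measureReal_le_one
    have hm1 := hmass (fun β => piFSGLD u (σ β) β) (fun β hβ => hprob' hβ)
      fun β hβ => (hb β hβ).2.2.1
    have hm2 := hmass (fun β => piStar u (σ β) β) (fun β hβ => hprob hβ)
      fun β hβ => (hb β hβ).2.2.2
    have hlim : Tendsto (fun β : ℝ =>
        (4 * (ENNReal.ofReal R ^ (2 : ℝ) * ENNReal.ofReal (1 - Real.exp (-(2 * (M * β ^ (-η)))) *
          (piFSGLD u (σ β) β).real (Metric.closedBall 0 R) *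
          (piStar u (σ β) β).real (Metric.closedBall 0 R))) +
        2 * ENNReal.ofReal (K * Real.exp (-β)) + 2 * ENNReal.ofReal (K * Real.exp (-β))) ^
          ((1 : ℝ) / 2)) atTop (𝓝 0) := by
      have h1 : Tendsto (fun β : ℝ => Real.exp (-(2 * (M * β ^ (-η))))) atTop (𝓝 1) := by
        have := (Real.continuous_exp.tendsto _).comp (hδ.const_mul 2).neg
        simpa [Function.comp_def] using this
      have h2 := ENNReal.tendsto_ofReal (((h1.mul hm1).mul hm2).const_sub 1)
      rw [mul_one, mul_one, sub_self, ENNReal.ofReal_zero] at h2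
      have h3 := ENNReal.tendsto_ofReal hexp
      rw [ENNReal.ofReal_zero] at h3
      have hR : ENNReal.ofReal R ^ (2 : ℝ) ≠ ∞ :=
        ENNReal.rpow_ne_top_of_nonneg zero_le_two ENNReal.ofReal_ne_top
      have h4 := ENNReal.Tendsto.const_mul (a := 4)
        (ENNReal.Tendsto.const_mul (a := ENNReal.ofReal R ^ (2 : ℝ)) h2 (Or.inr hR))
        (Or.inr (by norm_num))
      have h5 := ENNReal.Tendsto.const_mul (a := 2) h3 (Or.inr (by norm_num))
      have h6 := ((h4.add h5).add h5).ennrpow_const ((1 : ℝ) / 2)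
      simpa using h6
    refine tendsto_of_tendsto_of_tendsto_of_le_of_le' tendsto_const_nhds hlim
      (Eventually.of_forall fun _ => zero_le) ?_
    filter_upwards [eventually_ge_atTop 1] with β hβ
    obtain ⟨hD, hball, ht1, ht2⟩ := hb β hβ
    have := hprob hβ
    have h1 := lintegral_enorm_sq_le_of_tail ht1
    have h2 := lintegral_enorm_sq_le_of_tail ht2
    rw [piFSGLD_eq_tilted (hint hβ)] at h1 ⊢
    refine (wasserstein_two_tilted_le (R := R) (hF _ _) (by positivity) hD hball).trans ?_
    gcongr

end Convergence

theorem mainTheorem1 {Ω : Type*} [MeasurableSpace Ω] (P : Measure Ω) [IsProbabilityMeasure P]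
    {d m : ℕ} (hd : 1 ≤ d) (hm : 1 ≤ m)
    (U : RR d → RR m → ℝ) (hU : Measurable (Function.uncurry U))
    (hUdiff : ∀ x, Differentiable ℝ fun θ => U θ x)
    (X : Ω → RR m) (hX : Measurable X)
    (hUint : ∀ θ, Integrable (fun ω => U θ (X ω)) P)
    (hu : ContDiff ℝ 4 (objective P U X))
    (hLip : LipschitzAssumption P U X)
    (hDiss : DissipativityAssumption P U X)
    (η : ℝ) (hη : 0 < η) (σ : ℝ → ℝ) (hσ : ∀ β, 0 < β → σ β = β ^ (-(1 + η) / 4)) :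
    (∀ β, 0 < β →
      (∀ θ, Integrable (fun z => objective P U X (θ + z)) (noiseLaw d (σ β))) ∧
      IsProbabilityMeasure (piFSGLD (objective P U X) (σ β) β) ∧
      IsProbabilityMeasure (piStar (objective P U X) (σ β) β)) ∧
    Tendsto (fun β : ℝ => InformationTheory.klDiv
      (piFSGLD (objective P U X) (σ β) β) (piStar (objective P U X) (σ β) β)) atTop (𝓝 0) ∧
    Tendsto (fun β : ℝ => wasserstein 2
      (piFSGLD (objective P U X) (σ β) β) (piStar (objective P U X) (σ β) β)) atTop (𝓝 0) := by
  have hdiff : Differentiable ℝ (objective P U X) := hu.differentiable (by norm_num)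
  obtain ⟨L, hL0, hL⟩ := exists_objective_second_difference_le hUdiff hUint hLip
  obtain ⟨a, b, ha, hdiss⟩ := exists_objective_dissipative hUdiff hUint hLip hDiss hdiff
  obtain ⟨C, hlow⟩ := exists_quadratic_lower_bound hdiff ha hdiss
  have hc : 0 < a / 4 := by positivity
  have hint : ∀ σ θ, Integrable (fun z => objective P U X (θ + z)) (noiseLaw d σ) := fun σ θ =>
    integrable_comp_add_noiseLaw hu.continuous hL
      (fun θ => (by linarith [hlow θ, mul_nonneg hc.le (sq_nonneg ‖θ‖)] :
        -C ≤ objective P U X θ)) σ θ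
  exact ⟨fun β hβ => ⟨hint _, isProbabilityMeasure_piFSGLD hu hL hint hc hlow _ hβ,
    isProbabilityMeasure_tilted (integrable_exp_flatObjective hu hL hc hlow _ hβ)⟩,
    tendsto_klDiv_and_wasserstein hu hL hL0 hc hlow hη hσ⟩
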